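/- Let $C=\begin{pmatrix}1&0\\1&1\end{pmatrix}$ and let $Q\subset SL(2,\mathbb{C})$ be the conjugacy class of $C$, with the subspace topology and the quandle operation $h\star g=g^{-1}hg$. For $n\ge 1$ the braid group $B_n$ acts from the right on $Q^n$; the elementary braid $\sigma_i$ acts by $$\sigma_i(x_1,\dots,x_n)=(x_1,\dots,x_{i-1},\,x_{i+1},\,x_i\star x_{i+1},\,x_{i+2},\dots,x_n).$$ For a link $L$ presented as the closure of a braid $\sigma\in B_n$, the invariant space $J_Q(L)$ is the subspace of $Q^n$ of all fixed points of $\sigma$. Let $K_3$ be the trefoil knot, presented as the closure of $\sigma_1^{-3}\in B_2$, so that $J_Q(K_3)\subset Q\times Q$. Let $Y=(\mathbb{C}^2\setminus\{0\})/\pm1$, write $[a,b]\in Y$ for the class of $(a,b)$, and for $[c,d]\in Y$ write $$M_{[c,d]}=\begin{pmatrix}1-cd&-d^2\\c^2&1+cd\end{pmatrix}\in Q .$$ For $(a,b)\neq(0,0)$ put $\tilde a=\bar a/(|a|^2+|b|^2)$ and $\tilde b=\bar b/(|a|^2+|b|^2)$, and let $$F:Y\times\mathbb{C}\to Q\times Q,\qquad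 F([a,b],\alpha)=\bigl(M_{[a,b]},\,M_{[\alpha a-\tilde b,\ \alpha b+\tilde a]}\bigr).$$ **Proposition 6.2.** The space $J_Q(K_3)$ has exactly two connected components. One of them is the diagonal $\{(g,g): g\in Q\}$, and it is diffeomorphic to $\mathbb{RP}^3\times\mathbb{R}$. The other one is the image of $F$; the map $F$ is a diffeomorphism of $Y\times\mathbb{C}$ onto it, and it is diffeomorphic to $\mathbb{RP}^3\times\mathbb{R}^3$. Here both components carry the smooth structure of embedded real submanifolds of the real vector space $M_2(\mathbb{C})\times M_2(\mathbb{C})$, and $Y$ and $\mathbb{RP}^3=S^3/\pm1$ carry the quotient smooth structures. -/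

import Mathlib

open scoped Manifold ContDiff
open scoped Matrix Topology

noncomputable section

/-! ### Topological quandles -/

/-- A topological quandle: a space with a continuous operation `a ⋆ b` such that every right
translation `a ↦ a ⋆ b` is a homeomorphism, with `(a ⋆ b) ⋆ c = (a ⋆ c) ⋆ (b ⋆ c)`
and `a ⋆ a = a`. -/
class TopologicalQuandle (X : Type*) [TopologicalSpace X] where
  /-- the quandle operation `a ⋆ b` -/
  op : X → X → X
  continuous_op : Continuous fun p : X × X => op p.1 p.2
  isHomeomorph_op : ∀ b : X, IsHomeomorph fun a => op a b
  op_op : ∀ a b c : X, op (op a b) c = op (op a c) (op b c)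
  op_self : ∀ a : X, op a a = a

/-- A conjugacy class of a topological group, with the subspace topology, is a topological quandle
under `h ⋆ g = g⁻¹ h g`. -/
instance conjugacyClassQuandle {G : Type*} [Group G] [TopologicalSpace G] [IsTopologicalGroup G]
    (c : G) : TopologicalQuandle (conjugatesOf c) where
  op h g := ⟨(g : G)⁻¹ * h * g,
    IsConj.trans h.2 (isConj_iff.2 ⟨(g : G)⁻¹, by simp⟩)⟩
  continuous_op := by
    refine Continuous.subtype_mk ?_ _
    fun_prop
  isHomeomorph_op b := by
    refine isHomeomorph_iff_exists_inverse.2 ⟨?_, fun h => ⟨(b : G) * h * (b : G)⁻¹,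
      IsConj.trans h.2 (isConj_iff.2 ⟨(b : G), by simp⟩)⟩, fun a => ?_, fun a => ?_, ?_⟩
    · refine Continuous.subtype_mk ?_ _
      fun_prop
    · apply Subtype.ext
      simp [mul_assoc]
    · apply Subtype.ext
      simp [mul_assoc]
    · refine Continuous.subtype_mk ?_ _
      fun_prop
  op_op a b c := by
    apply Subtype.ext
    simp [mul_assoc]
  op_self a := by
    apply Subtype.ext
    simp

/-! ### Braid groups, their action on powers of a quandle, and the invariant space -/

/-- The braid relations between the generators `σ₀, …, σₙ₋₂`:
`σᵢ σⱼ = σⱼ σᵢ` for `|i - j| > 1` and `σᵢ σᵢ₊₁ σᵢ = σᵢ₊₁ σᵢ σᵢ₊₁`. -/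
def braidRelations (n : ℕ) : Set (FreeGroup (Fin (n - 1))) :=
  {r | ∃ i j : Fin (n - 1), (i : ℕ) + 1 < j ∧
      r = FreeGroup.of i * FreeGroup.of j * (FreeGroup.of j * FreeGroup.of i)⁻¹} ∪
  {r | ∃ i j : Fin (n - 1), (i : ℕ) + 1 = j ∧
      r = FreeGroup.of i * FreeGroup.of j * FreeGroup.of i *
        (FreeGroup.of j * FreeGroup.of i * FreeGroup.of j)⁻¹}

/-- The braid group on `n` strands. -/
abbrev BraidGroup (n : ℕ) : Type := PresentedGroup (braidRelations n)

/-- The elementary braids (numbered from `0`). -/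
def BraidGroup.σ {n : ℕ} (i : Fin (n - 1)) : BraidGroup n := PresentedGroup.of i

section BraidAction

variable {X : Type*} [TopologicalSpace X] [TopologicalQuandle X] {n : ℕ}

/-- The elementary braid `σᵢ` acting on `X × ⋯ × X`: it replaces the `i`-th coordinate by `xᵢ₊₁`,
the `(i+1)`-st by `xᵢ ⋆ xᵢ₊₁`, and keeps the others. -/
def elementaryBraidMap (i : Fin (n - 1)) (x : Fin n → X) : Fin n → X := fun j =>
  if (j : ℕ) = i then x ⟨i + 1, by omega⟩
  else if (j : ℕ) = i + 1 then
    TopologicalQuandle.op (x ⟨i, by omega⟩) (x ⟨i + 1, by omega⟩)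
  else x j

theorem elementaryBraidMap_bijective (i : Fin (n - 1)) :
    Function.Bijective (elementaryBraidMap (X := X) i) := by
  constructor
  · intro x y h
    have h1 := congrFun h ⟨i, by omega⟩
    have h2 := congrFun h ⟨i + 1, by omega⟩
    simp [elementaryBraidMap] at h1 h2
    rw [h1] at h2
    have h3 := (TopologicalQuandle.isHomeomorph_op (y ⟨i + 1, by omega⟩)).injective h2
    funext j
    by_cases hj : (j : ℕ) = i
    · convert h3
    by_cases hj' : (j : ℕ) = i + 1
    · convert h1
    · simpa [elementaryBraidMap, hj, hj'] using congrFun h j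
  · intro y
    obtain ⟨z, hz⟩ := (TopologicalQuandle.isHomeomorph_op (y ⟨i, by omega⟩)).surjective
      (y ⟨i + 1, by omega⟩)
    refine ⟨fun j => if (j : ℕ) = i then z else if (j : ℕ) = i + 1 then y ⟨i, by omega⟩ else y j, ?_⟩
    funext j
    by_cases hj : (j : ℕ) = i
    · have : y j = y ⟨i, by omega⟩ := congrArg y (Fin.ext hj)
      simp [elementaryBraidMap, hj, this]
    by_cases hj' : (j : ℕ) = i + 1
    · have : y j = y ⟨i + 1, by omega⟩ := congrArg y (Fin.ext hj')
      simpa [elementaryBraidMap, hj', this] using hz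
    · simp [elementaryBraidMap, hj, hj']

/-- The elementary braid as a permutation of `X × ⋯ × X`. -/
def elementaryBraidPerm (X : Type*) [TopologicalSpace X] [TopologicalQuandle X] {n : ℕ}
    (i : Fin (n - 1)) : Equiv.Perm (Fin n → X) :=
  Equiv.ofBijective (elementaryBraidMap i) (elementaryBraidMap_bijective i)

theorem elementaryBraidPerm_relations (r : FreeGroup (Fin (n - 1))) (hr : r ∈ braidRelations n) :
    FreeGroup.lift (fun i => MulOpposite.op (elementaryBraidPerm X i)) r = 1 := by
  rcases hr with ⟨i, j, hij, rfl⟩ | ⟨i, j, hij, rfl⟩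
  · rw [map_mul, map_inv, mul_inv_eq_one]
    simp only [map_mul, FreeGroup.lift_apply_of]
    rw [← MulOpposite.op_mul, ← MulOpposite.op_mul]
    congr 1
    ext x k
    simp only [Equiv.Perm.mul_apply, elementaryBraidPerm, Equiv.ofBijective_apply]
    simp only [elementaryBraidMap]
    grind
  · rw [map_mul, map_inv, mul_inv_eq_one]
    simp only [map_mul, FreeGroup.lift_apply_of]
    simp only [← MulOpposite.op_mul]
    congr 1
    ext x k
    simp only [Equiv.Perm.mul_apply, elementaryBraidPerm, Equiv.ofBijective_apply]
    simp only [elementaryBraidMap, ← hij]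
    have := @TopologicalQuandle.op_op X _ _
    grind

/-- The right action of the braid group `Bₙ` on the `n`-th power of a quandle `X`; being a right
action, it is a homomorphism into the opposite of the permutation group. -/
def braidAction (X : Type*) [TopologicalSpace X] [TopologicalQuandle X] (n : ℕ) :
    BraidGroup n →* (Equiv.Perm (Fin n → X))ᵐᵒᵖ :=
  PresentedGroup.toGroup (f := fun i => MulOpposite.op (elementaryBraidPerm X i))
    elementaryBraidPerm_relations

/-- The invariant space `J_X(L)` of the link `L` presented as the closure of the braid `β` on `n`
strands: the subspace of `X × ⋯ × X` of all fixed points of `β`. -/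
def invariantSpace (X : Type*) [TopologicalSpace X] [TopologicalQuandle X] {n : ℕ}
    (β : BraidGroup n) : Set (Fin n → X) :=
  {x | (braidAction X n β).unop x = x}

end BraidAction

/-- The trefoil knot is the closure of the braid `σ₁⁻³` on two strands. -/
def trefoilBraid : BraidGroup 2 := BraidGroup.σ (n := 2) 0 ^ (-3 : ℤ)

/-! ### Quotients of manifolds by free finite group actions -/

/-- The quotient of a smooth manifold by a free properly discontinuous action by smooth maps
is a smooth manifold. -/
theorem isManifold_orbitQuotient {E H M G : Type*} [NormedAddCommGroup E] [NormedSpace ℝ E]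
    [TopologicalSpace H] (I : ModelWithCorners ℝ E H) (n : ℕ∞ω)
    [TopologicalSpace M] [ChartedSpace H M] [IsManifold I n M] [Group G] [MulAction G M]
    [ProperlyDiscontinuousSMul G M] [ContinuousConstSMul G M] [IsCancelSMul G M]
    [T2Space M] [LocallyCompactSpace M] (hG : ∀ g : G, ContMDiff I I n fun x : M => g • x) :
    IsManifold I n (MulAction.orbitRel.Quotient G M) := by
  apply isManifold_of_contDiffOn
  rintro _ _ ⟨q, rfl⟩ ⟨q', rfl⟩
  generalize_proofs hloc hsec
  generalize hsec.choose = sec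
  set s := hloc.localInverseAt (sec q) with hs
  set s' := hloc.localInverseAt (sec q') with hs'
  have hsymm : ∀ m, s.symm m = (Quotient.mk _ m : MulAction.orbitRel.Quotient G M) :=
    fun m => congrFun (hloc.localInverseAt_symm _) m
  have hsymm' : ∀ m, s'.symm m = (Quotient.mk _ m : MulAction.orbitRel.Quotient G M) :=
    fun m => congrFun (hloc.localInverseAt_symm _) m
  rintro z ⟨hz, hzr⟩
  set c := chartAt H (sec q) with hc
  set c' := chartAt H (sec q') with hc'
  set m := c.symm (I.symm z) with hm
  have hz' : I.symm z ∈ c.target ∧ m ∈ s.target ∧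
      (Quotient.mk _ m : MulAction.orbitRel.Quotient G M) ∈ s'.source ∧
      s' (Quotient.mk _ m) ∈ c'.source := by
    simpa [hsymm, and_assoc] using hz
  obtain ⟨h1, h2, h3, h4⟩ := hz'
  obtain ⟨g, hg⟩ : ∃ g : G, g • m = s' (Quotient.mk _ m) := by
    have : (Quotient.mk _ (s' (Quotient.mk _ m)) : MulAction.orbitRel.Quotient G M)
        = Quotient.mk _ m := by
      rw [← hsymm', s'.left_inv h3]
    exact Quotient.exact this
  have hgm : Filter.Tendsto (fun x : M => g • x) (𝓝 m) (𝓝 (g • m)) :=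
    (continuous_const_smul g).tendsto m
  have hmem : g • m ∈ s'.target := by rw [hg]; exact s'.map_source h3
  have hev : ∀ᶠ x in 𝓝 m, s' (Quotient.mk _ x) = g • x := by
    filter_upwards [hgm (s'.open_target.mem_nhds hmem)] with x hx
    have : (Quotient.mk _ x : MulAction.orbitRel.Quotient G M) = s'.symm (g • x) := by
      rw [hsymm']
      exact (Quotient.sound ⟨g, rfl⟩ : (Quotient.mk _ (g • x) : MulAction.orbitRel.Quotient G M) = Quotient.mk _ x).symm
    rw [this, s'.right_inv hx]
  have hzt : z ∈ (extChartAt I (sec q)).target := by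
    rw [extChartAt_target]; exact ⟨h1, hzr⟩
  have hA : ContMDiffWithinAt 𝓘(ℝ, E) I n (extChartAt I (sec q)).symm (Set.range I) z :=
    contMDiffWithinAt_extChartAt_symm_range _ hzt
  have hB : ContMDiffAt I I n (fun x : M => g • x) ((extChartAt I (sec q)).symm z) := hG g _
  have hC : ContMDiffAt I 𝓘(ℝ, E) n (extChartAt I (sec q'))
      (g • ((extChartAt I (sec q)).symm z)) := by
    refine contMDiffAt_extChartAt' ?_
    have : (extChartAt I (sec q)).symm z = m := rfl
    rw [this, hg]
    exact h4
  have hD := (hC.comp_contMDiffWithinAt z (hB.comp_contMDiffWithinAt z hA)).contDiffWithinAt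
  refine (hD.mono Set.inter_subset_right).congr_of_eventuallyEq ?_ ?_
  · have hcont : ContinuousWithinAt (extChartAt I (sec q)).symm (Set.range I) z :=
      hA.continuousWithinAt
    have := (hcont.mono (Set.inter_subset_right :
      (I.symm ⁻¹' ((s.trans c).symm.trans (s'.trans c')).source ∩ Set.range I) ⊆ _)).eventually hev
    filter_upwards [this] with w hw
    have hw' : s' (Quotient.mk _ (c.symm (I.symm w))) = g • c.symm (I.symm w) := hw
    simp [hsymm, hw', c, c']
  · have hw' := hev.self_of_nhds
    simp [hsymm, ← hm, hw', c, c']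

/-! ### The real projective space `ℝP³` -/

theorem eq_zero_of_eq_neg_self {V : Type*} [AddCommGroup V] [Module ℝ V] {x : V} (h : x = -x) :
    x = 0 := by
  have h2 : (2 : ℝ) • x = 0 := by
    rw [two_smul]
    nth_rewrite 1 [h]
    exact neg_add_cancel x
  exact (smul_eq_zero.1 h2).resolve_left two_ne_zero

/-- The unit sphere `S³` in `ℝ⁴`. -/
abbrev S3 : Type := Metric.sphere (0 : EuclideanSpace ℝ (Fin 4)) 1

/-- The group `{±1}` acts on `S³`, with `-1` acting as the antipodal map. -/
instance : MulAction ℤˣ S3 where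
  smul u x := ⟨(u : ℤ) • (x : EuclideanSpace ℝ (Fin 4)), by
    rcases Int.units_eq_one_or u with rfl | rfl <;> simp⟩
  one_smul x := Subtype.ext (one_smul ℤ _)
  mul_smul u v x := Subtype.ext (by
    change ((u * v : ℤˣ) : ℤ) • (x : EuclideanSpace ℝ (Fin 4)) = (u : ℤ) • (v : ℤ) • _
    rw [Units.val_mul, mul_smul])

theorem S3.coe_smul (u : ℤˣ) (x : S3) :
    ((u • x : S3) : EuclideanSpace ℝ (Fin 4)) = (u : ℤ) • (x : EuclideanSpace ℝ (Fin 4)) := rfl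

instance : ContinuousConstSMul ℤˣ S3 where
  continuous_const_smul u := by
    refine Continuous.subtype_mk ?_ _
    fun_prop

instance : IsCancelSMul ℤˣ S3 where
  right_cancel' u v x h := by
    have hx : (x : EuclideanSpace ℝ (Fin 4)) ≠ 0 := ne_zero_of_mem_unit_sphere x
    have h' : (u : ℤ) • (x : EuclideanSpace ℝ (Fin 4)) = (v : ℤ) • (x : EuclideanSpace ℝ (Fin 4)) :=
      congrArg Subtype.val h
    rcases Int.units_eq_one_or u with rfl | rfl <;> rcases Int.units_eq_one_or v with rfl | rfl
    · rfl
    · exact absurd (eq_zero_of_eq_neg_self (by simpa using h')) hx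
    · exact absurd (eq_zero_of_eq_neg_self (by simpa using h'.symm)) hx
    · rfl

theorem S3.contMDiff_smul (n : ℕ∞ω) (u : ℤˣ) :
    ContMDiff (𝓡 3) (𝓡 3) n fun x : S3 => u • x := by
  have : Fact (Module.finrank ℝ (EuclideanSpace ℝ (Fin 4)) = 3 + 1) := ⟨by simp⟩
  refine ContMDiff.codRestrict_sphere (f := fun x : S3 => (u : ℤ) • (x : EuclideanSpace ℝ (Fin 4)))
    ?_ _
  exact (contDiff_const_smul (u : ℤ)).contMDiff.comp contMDiff_coe_sphere

/-- Real projective `3`-space: the quotient of `S³` by the antipodal map, with the quotient topology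
and the smooth structure for which `S³ → ℝP³` is a local diffeomorphism. -/
abbrev RP3 : Type := MulAction.orbitRel.Quotient ℤˣ S3

instance : IsManifold (𝓡 3) ∞ RP3 :=
  isManifold_orbitQuotient (𝓡 3) ∞ (S3.contMDiff_smul ∞)

/-! ### The space `Y = (ℂ² ∖ {0}) / ±1` -/

/-- The open subset `ℂ² ∖ {0}` of `ℂ²`. -/
def puncturedPlane : TopologicalSpace.Opens (ℂ × ℂ) := ⟨{0}ᶜ, isOpen_compl_singleton⟩

/-- The group `{±1}` acts on `ℂ² ∖ {0}` by multiplication. -/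
instance : MulAction ℤˣ puncturedPlane where
  smul u p := ⟨(u : ℤ) • (p : ℂ × ℂ), smul_ne_zero u.ne_zero p.2⟩
  one_smul x := Subtype.ext (one_smul ℤ _)
  mul_smul u v x := Subtype.ext (by
    change ((u * v : ℤˣ) : ℤ) • (x : ℂ × ℂ) = (u : ℤ) • (v : ℤ) • _
    rw [Units.val_mul, mul_smul])

theorem puncturedPlane.coe_smul (u : ℤˣ) (p : puncturedPlane) :
    ((u • p : puncturedPlane) : ℂ × ℂ) = (u : ℤ) • (p : ℂ × ℂ) := rfl

instance : ContinuousConstSMul ℤˣ puncturedPlane where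
  continuous_const_smul u := by
    refine Continuous.subtype_mk ?_ _
    fun_prop

instance : IsCancelSMul ℤˣ puncturedPlane where
  right_cancel' u v x h := by
    have hx : (x : ℂ × ℂ) ≠ 0 := x.2
    have h' : (u : ℤ) • (x : ℂ × ℂ) = (v : ℤ) • (x : ℂ × ℂ) := congrArg Subtype.val h
    rcases Int.units_eq_one_or u with rfl | rfl <;> rcases Int.units_eq_one_or v with rfl | rfl
    · rfl
    · exact absurd (eq_zero_of_eq_neg_self (by simpa using h')) hx
    · exact absurd (eq_zero_of_eq_neg_self (by simpa using h'.symm)) hx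
    · rfl

instance : LocallyCompactSpace puncturedPlane :=
  puncturedPlane.isOpen.locallyCompactSpace

theorem puncturedPlane.contMDiff_smul (n : ℕ∞ω) (u : ℤˣ) :
    ContMDiff 𝓘(ℝ, ℂ × ℂ) 𝓘(ℝ, ℂ × ℂ) n fun p : puncturedPlane => u • p := by
  refine contMDiff_iff_target.2 ⟨continuous_const_smul u, fun y => ?_⟩
  have : ContMDiff 𝓘(ℝ, ℂ × ℂ) 𝓘(ℝ, ℂ × ℂ) n fun p : puncturedPlane => (u : ℤ) • (p : ℂ × ℂ) :=
    (contDiff_const_smul (u : ℤ)).contMDiff.comp contMDiff_subtype_val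
  exact this.contMDiffOn

/-- The space `Y = (ℂ² ∖ {0}) / ±1`, with the quotient topology and the smooth structure for which
`ℂ² ∖ {0} → Y` is a local diffeomorphism. -/
abbrev SpaceY : Type := MulAction.orbitRel.Quotient ℤˣ puncturedPlane

instance : IsManifold 𝓘(ℝ, ℂ × ℂ) ∞ SpaceY :=
  isManifold_orbitQuotient 𝓘(ℝ, ℂ × ℂ) ∞ (puncturedPlane.contMDiff_smul ∞)

/-! ### The conjugacy class `Q` in `SL(2, ℂ)` -/

/-- The matrix `[[1, 0], [1, 1]]` in `SL(2, ℂ)`. -/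
def matC : Matrix.SpecialLinearGroup (Fin 2) ℂ := ⟨!![1, 0; 1, 1], by simp⟩

/-- The conjugacy class `Q` of `[[1, 0], [1, 1]]` in `SL(2, ℂ)`, a topological quandle under
`h ⋆ g = g⁻¹ h g`. -/
abbrev ClassQ : Type := conjugatesOf matC

/-- For `(a, b) ≠ 0`, the number `ã = conj a / (|a|² + |b|²)`. -/
def tilde₁ (p : ℂ × ℂ) : ℂ := star p.1 / ((‖p.1‖ ^ 2 + ‖p.2‖ ^ 2 : ℝ) : ℂ)

/-- For `(a, b) ≠ 0`, the number `b̃ = conj b / (|a|² + |b|²)`. -/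
def tilde₂ (p : ℂ × ℂ) : ℂ := star p.2 / ((‖p.1‖ ^ 2 + ‖p.2‖ ^ 2 : ℝ) : ℂ)

theorem tilde_spec {p : ℂ × ℂ} (hp : p ≠ 0) : p.1 * tilde₁ p + p.2 * tilde₂ p = 1 := by
  obtain ⟨a, b⟩ := p
  have h : (‖a‖ ^ 2 + ‖b‖ ^ 2 : ℝ) ≠ 0 := by
    intro h
    have ha : ‖a‖ ^ 2 = 0 := by nlinarith [sq_nonneg ‖a‖, sq_nonneg ‖b‖]
    have hb : ‖b‖ ^ 2 = 0 := by nlinarith [sq_nonneg ‖a‖, sq_nonneg ‖b‖]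
    exact hp (by simp_all)
  have h' : ((‖a‖ ^ 2 + ‖b‖ ^ 2 : ℝ) : ℂ) ≠ 0 := Complex.ofReal_ne_zero.2 h
  simp only [tilde₁, tilde₂]
  rw [mul_div_assoc', mul_div_assoc', ← add_div, div_eq_one_iff_eq h']
  simp [Complex.mul_conj, Complex.normSq_eq_norm_sq]

/-- The matrix `[[1 - ab, -b²], [a², 1 + ab]]` in `SL(2, ℂ)`. -/
def toSL (a b : ℂ) : Matrix.SpecialLinearGroup (Fin 2) ℂ :=
  ⟨!![1 - a * b, -b ^ 2; a ^ 2, 1 + a * b], by rw [Matrix.det_fin_two_of]; ring⟩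

theorem toSL_isConj {p : ℂ × ℂ} (hp : p ≠ 0) : IsConj matC (toSL p.1 p.2) := by
  have h := tilde_spec hp
  let A : Matrix.SpecialLinearGroup (Fin 2) ℂ :=
    ⟨!![p.1, p.2; -tilde₂ p, tilde₁ p], by
      rw [Matrix.det_fin_two_of]; linear_combination h⟩
  refine isConj_iff.2 ⟨A⁻¹, ?_⟩
  rw [inv_inv, mul_assoc, inv_mul_eq_iff_eq_mul]
  ext i j
  change (!![1, 0; 1, 1] * !![p.1, p.2; -tilde₂ p, tilde₁ p] : Matrix (Fin 2) (Fin 2) ℂ) i j =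
    (!![p.1, p.2; -tilde₂ p, tilde₁ p] *
      !![1 - p.1 * p.2, -p.2 ^ 2; p.1 ^ 2, 1 + p.1 * p.2] : Matrix (Fin 2) (Fin 2) ℂ) i j
  fin_cases i <;> fin_cases j <;> simp [Matrix.mul_apply, Fin.sum_univ_two] <;> grind

/-- The element `[[1 - ab, -b²], [a², 1 + ab]]` of `Q`, for `(a, b) ≠ 0`. -/
def toQ (p : puncturedPlane) : ClassQ := ⟨toSL (p : ℂ × ℂ).1 (p : ℂ × ℂ).2, toSL_isConj p.2⟩

/-- The vector `(α a - b̃, α b + ã)`. -/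
def companion (p : puncturedPlane) (α : ℂ) : puncturedPlane :=
  ⟨(α * p.1.1 - tilde₂ p, α * p.1.2 + tilde₁ p), by
    intro h0
    have h := tilde_spec p.2
    simp only [Set.mem_singleton_iff, Prod.mk_eq_zero] at h0
    have : (1 : ℂ) = 0 := by linear_combination -h + p.1.1 * h0.2 - p.1.2 * h0.1
    exact one_ne_zero this⟩

theorem toQ_smul (u : ℤˣ) (p : puncturedPlane) : toQ (u • p) = toQ p := by
  rcases Int.units_eq_one_or u with rfl | rfl
  · simp
  · apply Subtype.ext
    apply Subtype.ext
    simp [toQ, toSL, puncturedPlane.coe_smul]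

theorem companion_smul (u : ℤˣ) (p : puncturedPlane) (α : ℂ) :
    companion (u • p) α = u • companion p α := by
  rcases Int.units_eq_one_or u with rfl | rfl
  · simp
  · apply Subtype.ext
    simp [companion, puncturedPlane.coe_smul, tilde₁, tilde₂]
    constructor <;> ring

/-- The map `Y × ℂ → Q × Q` given by `([a, b], α) ↦ ([a, b], [α a - b̃, α b + ã])`, where a class
`[c, d]` in `Y` stands for the matrix `[[1 - cd, -d²], [c², 1 + cd]]` in `Q`. -/
def parametrization (z : SpaceY × ℂ) : Fin 2 → ClassQ :=
  Quotient.lift (fun p : puncturedPlane => ![toQ p, toQ (companion p z.2)]) (by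
    rintro _ p ⟨u, rfl⟩
    change ![toQ (u • p), toQ (companion (u • p) z.2)] = _
    rw [companion_smul, toQ_smul, toQ_smul]) z.1

/-! ### Diffeomorphism type of subsets of powers of `Q` -/

/-- The inclusion of `Q × Q` in the real vector space of pairs of complex `2 × 2` matrices. -/
def matrixEntries (x : Fin 2 → ClassQ) : Fin 2 → Fin 2 → Fin 2 → ℂ :=
  fun k i j => (x k : Matrix.SpecialLinearGroup (Fin 2) ℂ) i j

/-- The set `S` is an embedded smooth submanifold of the normed space `V`, and it is diffeomorphic
to the manifold `M`: it is the image of a smooth embedding of `M` in `V`. -/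
def IsDiffeomorphicTo {V : Type*} [NormedAddCommGroup V] [NormedSpace ℝ V] (S : Set V)
    {E H : Type*} [NormedAddCommGroup E] [NormedSpace ℝ E] [TopologicalSpace H]
    (I : ModelWithCorners ℝ E H) (M : Type*) [TopologicalSpace M] [ChartedSpace H M] : Prop :=
  ∃ f : M → V, Manifold.IsSmoothEmbedding I 𝓘(ℝ, V) ∞ f ∧ Set.range f = S

end

/-! For p = (a, b) put J p = (-b, a). Then M_p = 1 + N_p, where N_p = (J p) pᵀ has rank one and
square zero. The entries a², ab, b² determine p up to sign, so `toQ` induces a bijection of Y with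
Q. With D = det(p, q) one has N_p N_q N_p = -D² N_p, whence M_p M_q M_p - M_q M_p M_q = (1 - D²)(M_p
- M_q) and tr(M_p M_q) = 2 - D². A pair is fixed by σ₁⁻³ exactly when it satisfies the relation uvu
= vuv (`mem_invariantSpace_iff`), so the invariant space is the union of the diagonal and the locus
D² = 1 (`mem_invariantSpace_toQ_iff`). Choosing the sign of q so that D = 1, the solutions q form
the affine line α p + (-b̃, ã); hence the second locus is the image of F. Both pieces are images of
connected spaces, and the trace is 2 on one and 1 on the other, so they are the components.

The smooth statements require topological embeddings that are immersions. On the topological side,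
`quad` is proper, so Y → Q is a closed embedding (`isClosedEmbedding_yToQ`), and α is recovered
continuously from the two classes (`companionYInv`). On the differential side, the inverse function
theorem reduces immersivity to injective differentials (`isImmersion_of_injective_mfderiv`). These
may be checked before dividing by ±1, because the quotient maps are local diffeomorphisms
(`IsLocalDiffeomorph.isSmoothEmbedding_of_comp`). There they come from differentiable left inverses,
apart from the inclusion of the sphere and the explicit Jacobian of `quad`. Polar coordinates
commute with ±1 and carry ℝP³ × ℝ to Y, hence ℝP³ × ℝ³ to Y × ℂ. -/

/-! ### Immersions and the inverse function theorem -/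

section Immersion

open Module

variable {E F V : Type*} [NormedAddCommGroup E] [NormedSpace ℝ E] [FiniteDimensional ℝ E]
  [NormedAddCommGroup F] [NormedSpace ℝ F] [FiniteDimensional ℝ F]
  [NormedAddCommGroup V] [NormedSpace ℝ V] [FiniteDimensional ℝ V]

/-- An injective linear map extends to an isomorphism from the product with any space of
complementary dimension. -/
theorem ContinuousLinearMap.exists_extend_equiv_of_injective (A : E →L[ℝ] V)
    (hA : Function.Injective A) (hd : finrank ℝ E + finrank ℝ F = finrank ℝ V) :
    ∃ L : (E × F) ≃L[ℝ] V, ∀ u, L (u, 0) = A u := by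
  obtain ⟨C, hC⟩ := Submodule.exists_isCompl (LinearMap.range (A : E →ₗ[ℝ] V))
  let e₁ := LinearEquiv.ofInjective (A : E →ₗ[ℝ] V) hA
  have h₁ := e₁.finrank_eq
  have h₂ := Submodule.finrank_add_eq_of_isCompl hC
  let e₂ : F ≃ₗ[ℝ] C := LinearEquiv.ofFinrankEq _ _ (by omega)
  refine ⟨((e₁.prodCongr e₂).trans
    (Submodule.prodEquivOfIsCompl _ _ hC)).toContinuousLinearEquiv, fun u => ?_⟩
  simp [e₁]

/-- A smooth map with injective derivative looks like the inclusion `u ↦ (u, 0)` after a smooth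
change of coordinates in the codomain. -/
theorem ContDiffOn.exists_straightening {g : E → V} {U : Set E} (hU : IsOpen U)
    (hg : ContDiffOn ℝ ∞ g U) {a : E} (ha : a ∈ U) (hinj : Function.Injective (fderiv ℝ g a))
    (hd : finrank ℝ E + finrank ℝ F = finrank ℝ V) :
    ∃ (L : (E × F) ≃L[ℝ] V) (ψ : OpenPartialHomeomorph V V) (W : Set E),
      ContDiffOn ℝ ∞ ψ ψ.source ∧ ContDiffOn ℝ ∞ ψ.symm ψ.target ∧ IsOpen W ∧ W ⊆ U ∧ a ∈ W ∧
      ∀ u ∈ W, g u ∈ ψ.source ∧ ψ (g u) = L (u, 0) := by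
  have : CompleteSpace E := FiniteDimensional.complete ℝ E
  have : CompleteSpace F := FiniteDimensional.complete ℝ F
  obtain ⟨L, hL⟩ := (fderiv ℝ g a).exists_extend_equiv_of_injective hinj hd
  -- Thicken g by the complementary directions: the derivative of G at (a, 0) is the isomorphism L,
  -- so G is locally invertible there.
  let G : E × F → V := fun z => g z.1 + L (0, z.2)
  have hUF : IsOpen (U ×ˢ (Set.univ : Set F)) := hU.prod isOpen_univ
  have hG : ContDiffOn ℝ ∞ G (U ×ˢ (Set.univ : Set F)) := by
    refine (hg.comp contDiff_fst.contDiffOn fun z hz => hz.1).add (ContDiff.contDiffOn ?_)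
    fun_prop
  have hGa : HasFDerivAt G (L : (E × F) →L[ℝ] V) (a, 0) := by
    have h₁ : HasFDerivAt g (fderiv ℝ g a) a :=
      ((hg.contDiffAt (hU.mem_nhds ha)).differentiableAt (by simp)).hasFDerivAt
    have h₂ : HasFDerivAt (fun z : E × F => L (0, z.2))
        ((L : (E × F) →L[ℝ] V).comp ((ContinuousLinearMap.inr ℝ E F).comp
          (ContinuousLinearMap.snd ℝ E F))) (a, 0) :=
      ((L : (E × F) →L[ℝ] V).comp ((ContinuousLinearMap.inr ℝ E F).comp
          (ContinuousLinearMap.snd ℝ E F))).hasFDerivAt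
    have h₃ := (HasFDerivAt.comp (a, (0 : F)) (f := Prod.fst) (g := g) h₁ hasFDerivAt_fst).add h₂
    convert! h₃ using 1
    ext u
    · simp [hL]
    · simp
  have haUF : (a, (0 : F)) ∈ U ×ˢ (Set.univ : Set F) := ⟨ha, trivial⟩
  let Γ₀ := (hG.contDiffAt (hUF.mem_nhds haUF)).toOpenPartialHomeomorph G hGa (by simp)
  -- The inverse function theorem gives smoothness of the inverse at one point only. Restricting to
  -- the open set where the derivative of G is invertible makes the inverse smooth on its whole
  -- domain.
  let O : Set (E × F) := (U ×ˢ (Set.univ : Set F)) ∩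
    fderiv ℝ G ⁻¹' Set.range ((↑) : ((E × F) ≃L[ℝ] V) → (E × F) →L[ℝ] V)
  have hO : IsOpen O := (hG.continuousOn_fderiv_of_isOpen hUF (by simp)).isOpen_inter_preimage hUF
    ContinuousLinearEquiv.isOpen
  let Γ := Γ₀.restrOpen O hO
  have hΓs : Γ.source = Γ₀.source ∩ O := rfl
  have hΓG : ∀ z, Γ z = G z := fun z => rfl
  have haΓ : (a, (0 : F)) ∈ Γ.source :=
    ⟨ContDiffAt.mem_toOpenPartialHomeomorph_source _ _ _, haUF, L, hGa.fderiv.symm⟩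
  -- Since G(u, 0) = g u, the coordinate change ψ = L ∘ Γ⁻¹ sends g u to L(u, 0).
  refine ⟨L, Γ.symm.trans L.toHomeomorph.toOpenPartialHomeomorph, {u | (u, (0 : F)) ∈ Γ.source},
    ?_, ?_, ?_, ?_, haΓ, ?_⟩
  · have h : ContDiffOn ℝ ∞ Γ.symm Γ.target := by
      intro y hy
      have hy' : Γ.symm y ∈ Γ.source := Γ.map_target hy
      obtain ⟨-, hyU, A, hA⟩ := hy'
      refine (Γ.contDiffAt_symm (f₀' := A) hy ?_ ?_).contDiffWithinAt
      · rw [hA]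
        exact ((hG.contDiffAt (hUF.mem_nhds hyU)).differentiableAt (by simp)).hasFDerivAt
      · exact hG.contDiffAt (hUF.mem_nhds hyU)
    have h' := L.contDiff.comp_contDiffOn (n := ∞) h
    simpa using h'
  · have h : ContDiffOn ℝ ∞ Γ Γ.source := hG.mono fun z hz => hz.2.1
    have h' := h.comp (L.symm.contDiff (n := ∞)).contDiffOn (s := L.symm ⁻¹' Γ.source)
      (fun z hz => hz)
    simpa using h'
  · exact Γ.open_source.preimage (by fun_prop)
  · exact fun u hu => hu.2.1.1
  · intro u hu
    have hgu : Γ (u, 0) = g u := by simp [hΓG, G, Prod.mk_zero_zero]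
    constructor
    · simpa [← hgu] using Γ.map_source hu
    · simp [← hgu, Γ.left_inv hu]

variable {H M : Type*} [TopologicalSpace H] {I : ModelWithCorners ℝ E H} [I.Boundaryless]
  [TopologicalSpace M] [ChartedSpace H M] [IsManifold I ∞ M]

/-- A smooth map from a finite-dimensional manifold to a finite-dimensional vector space, all of
whose differentials are injective, is an immersion. -/
theorem isImmersion_of_injective_mfderiv {f : M → V} (hf : ContMDiff I 𝓘(ℝ, V) ∞ f)
    (hinj : ∀ x, Function.Injective (mfderiv I 𝓘(ℝ, V) f x)) :
    Manifold.IsImmersion I 𝓘(ℝ, V) ∞ f := by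
  -- The inequality of dimensions, needed to choose the complement, is read off from the
  -- differential at a point.
  rcases isEmpty_or_nonempty M with hM | ⟨⟨x₀⟩⟩
  · exact Manifold.IsImmersionOfComplement.isImmersion (F := PUnit.{1}) fun x => (hM.false x).elim
  have hle : finrank ℝ E ≤ finrank ℝ V :=
    LinearMap.finrank_le_finrank_of_injective
      (f := (show E →L[ℝ] V from mfderiv I 𝓘(ℝ, V) f x₀).toLinearMap) (hinj x₀)
  refine Manifold.IsImmersionOfComplement.isImmersion
    (F := EuclideanSpace ℝ (Fin (finrank ℝ V - finrank ℝ E))) fun x => ?_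
  have hU : IsOpen (extChartAt I x).target := isOpen_extChartAt_target x
  have hg : ContDiffOn ℝ ∞ (f ∘ (extChartAt I x).symm) (extChartAt I x).target := by
    rw [← contMDiffOn_iff_contDiffOn]
    exact hf.comp_contMDiffOn (contMDiffOn_extChartAt_symm x)
  have hd : fderiv ℝ (f ∘ (extChartAt I x).symm) (extChartAt I x x) = mfderiv I 𝓘(ℝ, V) f x := by
    rw [(hf.mdifferentiableAt (by simp)).mfderiv, I.range_eq_univ, fderivWithin_univ]
    rfl
  obtain ⟨L, ψ, W, hψ, hψ', hW, hWU, hxW, hWψ⟩ := hg.exists_straightening hU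
    (F := EuclideanSpace ℝ (Fin (finrank ℝ V - finrank ℝ E)))
    (mem_extChartAt_target x) (by rw [hd]; exact hinj x) (by simp; omega)
  have hO : IsOpen ((chartAt H x).source ∩ chartAt H x ⁻¹' (I ⁻¹' W)) :=
    (chartAt H x).isOpen_inter_preimage (hW.preimage I.continuous)
  have hψm : ψ ∈ IsManifold.maximalAtlas 𝓘(ℝ, V) ∞ V :=
    ψ.mem_maximalAtlas_of_contMDiffOn hψ.contMDiffOn hψ'.contMDiffOn
  -- The straightening holds on W only, so the chart of the domain is shrunk to the part lying over
  -- W.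
  have hφm : (chartAt H x).restr ((chartAt H x).source ∩ chartAt H x ⁻¹' (I ⁻¹' W)) ∈
      IsManifold.maximalAtlas I ∞ M :=
    restr_mem_maximalAtlas (contDiffGroupoid ∞ I) (IsManifold.chart_mem_maximalAtlas x) hO
  have hxs : x ∈ ((chartAt H x).restr
      ((chartAt H x).source ∩ chartAt H x ⁻¹' (I ⁻¹' W))).source := by
    rw [OpenPartialHomeomorph.restr_source, hO.interior_eq]
    exact ⟨mem_chart_source H x, mem_chart_source H x, hxW⟩
  have hfψ : f x ∈ ψ.source := by simpa using (hWψ _ hxW).1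
  refine Manifold.IsImmersionAtOfComplement.mk_of_continuousAt hf.continuous.continuousAt L
    _ ψ hxs hfψ hφm hψm ?_
  intro u hu
  have hu' : u ∈ W := by
    have hu₁ := (OpenPartialHomeomorph.extend _ I).map_target hu
    rw [OpenPartialHomeomorph.extend_source, OpenPartialHomeomorph.restr_source,
      hO.interior_eq] at hu₁
    have hu₂ : (extChartAt I x) ((extChartAt I x).symm u) ∈ W := hu₁.2.2
    rwa [(extChartAt I x).right_inv] at hu₂
    simp only [mfld_simps] at hu
    rw [extChartAt_target]
    exact ⟨hu.2.1, hu.1⟩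
  exact (hWψ u hu').2

end Immersion

/-! ### Maps with injective differential -/

section InjectiveDifferential

variable {E E' E'' E₁ E₁' : Type*} [NormedAddCommGroup E] [NormedSpace ℝ E]
  [NormedAddCommGroup E'] [NormedSpace ℝ E'] [NormedAddCommGroup E''] [NormedSpace ℝ E'']
  [NormedAddCommGroup E₁] [NormedSpace ℝ E₁] [NormedAddCommGroup E₁'] [NormedSpace ℝ E₁']
  {H H' H'' H₁ H₁' : Type*} [TopologicalSpace H] [TopologicalSpace H'] [TopologicalSpace H'']
  [TopologicalSpace H₁] [TopologicalSpace H₁']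
  {I : ModelWithCorners ℝ E H} {I' : ModelWithCorners ℝ E' H'} {I'' : ModelWithCorners ℝ E'' H''}
  {I₁ : ModelWithCorners ℝ E₁ H₁} {I₁' : ModelWithCorners ℝ E₁' H₁'}
  {M M' M'' M₁ M₁' : Type*} [TopologicalSpace M] [ChartedSpace H M]
  [TopologicalSpace M'] [ChartedSpace H' M'] [TopologicalSpace M''] [ChartedSpace H'' M'']
  [TopologicalSpace M₁] [ChartedSpace H₁ M₁] [TopologicalSpace M₁'] [ChartedSpace H₁' M₁']

variable (I I') in
/-- The map `f` is differentiable at `x`, with injective differential. -/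
def HasInjectiveMFDerivAt (f : M → M') (x : M) : Prop :=
  MDifferentiableAt I I' f x ∧ Function.Injective (mfderiv I I' f x)

namespace HasInjectiveMFDerivAt

theorem comp {g : M' → M''} {f : M → M'} {x : M} (hg : HasInjectiveMFDerivAt I' I'' g (f x))
    (hf : HasInjectiveMFDerivAt I I' f x) : HasInjectiveMFDerivAt I I'' (g ∘ f) x := by
  refine ⟨hg.1.comp x hf.1, ?_⟩
  rw [mfderiv_comp x hg.1 hf.1]
  exact hg.2.comp hf.2

/-- By the chain rule. Taking for g a left inverse of f, possibly only up to an inclusion, gives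
injectivity without computing the differential of f. -/
theorem of_comp {g : M' → M''} {f : M → M'} {x : M} (hg : MDifferentiableAt I' I'' g (f x))
    (hf : MDifferentiableAt I I' f x) (h : HasInjectiveMFDerivAt I I'' (g ∘ f) x) :
    HasInjectiveMFDerivAt I I' f x := by
  refine ⟨hf, ?_⟩
  have h₂ := h.2
  rw [mfderiv_comp x hg hf] at h₂
  exact Function.Injective.of_comp (f := mfderiv I' I'' g (f x)) h₂

theorem id (x : M) : HasInjectiveMFDerivAt I I (id : M → M) x := by
  refine ⟨mdifferentiableAt_id, ?_⟩
  rw [mfderiv_id]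
  exact Function.injective_id

theorem congr {f g : M → M'} {x : M} (hf : HasInjectiveMFDerivAt I I' f x) (h : f =ᶠ[𝓝 x] g) :
    HasInjectiveMFDerivAt I I' g x := by
  refine ⟨hf.1.congr_of_eventuallyEq h.symm, ?_⟩
  have := hf.2
  rwa [h.mfderiv_eq] at this

theorem prodMap {f : M → M'} {g : M₁ → M₁'} {x : M} {y : M₁} (hf : HasInjectiveMFDerivAt I I' f x)
    (hg : HasInjectiveMFDerivAt I₁ I₁' g y) :
    HasInjectiveMFDerivAt (I.prod I₁) (I'.prod I₁') (Prod.map f g) (x, y) := by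
  refine ⟨hf.1.prodMap hg.1, ?_⟩
  have h₁ : HasMFDerivAt (I.prod I₁) I' (fun p : M × M₁ => f p.1) (x, y) _ :=
    HasMFDerivAt.comp (x, y) (f := Prod.fst) hf.1.hasMFDerivAt (hasMFDerivAt_fst (x, y))
  have h₂ : HasMFDerivAt (I.prod I₁) I₁' (fun p : M × M₁ => g p.2) (x, y) _ :=
    HasMFDerivAt.comp (x, y) (f := Prod.snd) hg.1.hasMFDerivAt (hasMFDerivAt_snd (x, y))
  have h : HasMFDerivAt (I.prod I₁) (I'.prod I₁') (Prod.map f g) (x, y) _ := h₁.prodMk h₂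
  rw [h.mfderiv]
  rintro ⟨u, v⟩ ⟨u', v'⟩ huv
  have e₁ : mfderiv I I' f x u = mfderiv I I' f x u' := congrArg Prod.fst huv
  have e₂ : mfderiv I₁ I₁' g y v = mfderiv I₁ I₁' g y v' := congrArg Prod.snd huv
  exact Prod.ext (hf.2 e₁) (hg.2 e₂)

theorem _root_.IsLocalDiffeomorphAt.hasInjectiveMFDerivAt {f : M → M'} {x : M}
    (hf : IsLocalDiffeomorphAt I I' ∞ f x) : HasInjectiveMFDerivAt I I' f x :=
  ⟨hf.mdifferentiableAt (by simp), (hf.mfderivToContinuousLinearEquiv (by simp)).injective⟩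

theorem of_hasFDerivAt {f : E → E'} {f' : E →L[ℝ] E'} {x : E} (hf : HasFDerivAt f f' x)
    (h : Function.Injective f') : HasInjectiveMFDerivAt 𝓘(ℝ, E) 𝓘(ℝ, E') f x := by
  refine ⟨hf.differentiableAt.mdifferentiableAt, ?_⟩
  rw [mfderiv_eq_fderiv, hf.fderiv]
  exact h

end HasInjectiveMFDerivAt

/-- A product of local diffeomorphisms is a local diffeomorphism. -/
theorem IsLocalDiffeomorphAt.prodMap {f : M → M'} {g : M₁ → M₁'} {x : M} {y : M₁} {n : ℕ∞ω}
    (hf : IsLocalDiffeomorphAt I I' n f x) (hg : IsLocalDiffeomorphAt I₁ I₁' n g y) :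
    IsLocalDiffeomorphAt (I.prod I₁) (I'.prod I₁') n (Prod.map f g) (x, y) := by
  obtain ⟨Φ, hx, hΦ⟩ := hf
  obtain ⟨Ψ, hy, hΨ⟩ := hg
  refine ⟨⟨Φ.toPartialEquiv.prod Ψ.toPartialEquiv, Φ.open_source.prod Ψ.open_source,
    Φ.open_target.prod Ψ.open_target, ?_, ?_⟩, ⟨hx, hy⟩, ?_⟩
  · exact Φ.contMDiffOn_toFun.prodMap Ψ.contMDiffOn_toFun
  · exact Φ.contMDiffOn_invFun.prodMap Ψ.contMDiffOn_invFun
  · exact fun p hp => Prod.ext (hΦ hp.1) (hΨ hp.2)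

/-- The product of a local diffeomorphism with an identity map is a local diffeomorphism. -/
theorem IsLocalDiffeomorph.prodMap_id {f : M → M'} {n : ℕ∞ω} (hf : IsLocalDiffeomorph I I' n f) :
    IsLocalDiffeomorph (I.prod I₁) (I'.prod I₁) n (Prod.map f (id : M₁ → M₁)) :=
  fun p => (hf p.1).prodMap ((Diffeomorph.refl I₁ M₁ n).isLocalDiffeomorph p.2)

/-- Smoothness descends along surjective local diffeomorphisms. -/
theorem IsLocalDiffeomorph.contMDiff_of_comp {π : M → M'} (hπ : IsLocalDiffeomorph I I' ∞ π)
    (hs : Function.Surjective π) {f : M' → M''} (hf : ContMDiff I I'' ∞ (f ∘ π)) :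
    ContMDiff I' I'' ∞ f := by
  intro y
  obtain ⟨x, rfl⟩ := hs y
  have h := (hf _).comp (π x) (hπ x).localInverse_contMDiffAt
  refine h.congr_of_eventuallyEq ?_
  filter_upwards [(hπ x).localInverse_eventuallyEq_right] with z hz
  exact congrArg f hz.symm

/-- Injectivity of the differential descends along surjective local diffeomorphisms. -/
theorem IsLocalDiffeomorph.hasInjectiveMFDerivAt_of_comp {π : M → M'}
    (hπ : IsLocalDiffeomorph I I' ∞ π) (hs : Function.Surjective π) {f : M' → M''}
    (hf : ∀ x, HasInjectiveMFDerivAt I I'' (f ∘ π) x) (y : M') :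
    HasInjectiveMFDerivAt I' I'' f y := by
  obtain ⟨x, rfl⟩ := hs y
  have h := (hf _).comp (hπ x).localInverse_isLocalDiffeomorphAt.hasInjectiveMFDerivAt
  refine h.congr ?_
  filter_upwards [(hπ x).localInverse_eventuallyEq_right] with z hz
  exact congrArg f hz

/-- A topological embedding of a quotient of a manifold in a vector space is a smooth embedding if
its lift is smooth with injective differentials. -/
theorem IsLocalDiffeomorph.isSmoothEmbedding_of_comp [FiniteDimensional ℝ E']
    [FiniteDimensional ℝ E''] [I'.Boundaryless] [IsManifold I' ∞ M'] {π : M → M'}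
    (hπ : IsLocalDiffeomorph I I' ∞ π) (hs : Function.Surjective π) {f : M' → E''}
    (he : Topology.IsEmbedding f) (hf : ContMDiff I 𝓘(ℝ, E'') ∞ (f ∘ π))
    (hi : ∀ x, HasInjectiveMFDerivAt I 𝓘(ℝ, E'') (f ∘ π) x) :
    Manifold.IsSmoothEmbedding I' 𝓘(ℝ, E'') ∞ f :=
  ⟨isImmersion_of_injective_mfderiv (hπ.contMDiff_of_comp hs hf)
    fun y => (hπ.hasInjectiveMFDerivAt_of_comp hs hi y).2, he⟩

end InjectiveDifferential

/-! ### The projection to a quotient manifold -/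

section OrbitQuotient

variable {E H M G : Type*} [NormedAddCommGroup E] [NormedSpace ℝ E]
  [TopologicalSpace H] (I : ModelWithCorners ℝ E H) (n : ℕ∞ω)
  [TopologicalSpace M] [ChartedSpace H M] [IsManifold I n M] [Group G] [MulAction G M]
  [ProperlyDiscontinuousSMul G M] [ContinuousConstSMul G M] [IsCancelSMul G M]
  [T2Space M] [LocallyCompactSpace M]

/-- The projection of a manifold to its quotient by a free properly discontinuous action by smooth
maps is a local diffeomorphism. -/
theorem isLocalDiffeomorph_orbitQuotient (hG : ∀ g : G, ContMDiff I I n fun x : M => g • x) :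
    IsLocalDiffeomorph I I n (Quotient.mk _ : M → MulAction.orbitRel.Quotient G M) := by
  have hman := isManifold_orbitQuotient I n hG
  intro x
  set q : MulAction.orbitRel.Quotient G M := Quotient.mk _ x with hq
  have hloc : IsLocalHomeomorph (Quotient.mk _ : M → MulAction.orbitRel.Quotient G M) :=
    isQuotientCoveringMap_quotientMk_of_properlyDiscontinuousSMul.isCoveringMap.isLocalHomeomorph
  -- The chart at q is built from a chosen representative y of the orbit, which need not be x. At y
  -- the projection is the chart of M followed by the inverse of the chart at q.
  obtain ⟨y, hy, hchart⟩ : ∃ y : M, (Quotient.mk _ y : MulAction.orbitRel.Quotient G M) = q ∧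
      chartAt H q = (hloc.localInverseAt y).trans (chartAt H y) :=
    ⟨_, (Quotient.mk_surjective.hasRightInverse.choose_spec :
      Function.RightInverse _ (Quotient.mk _ : M → MulAction.orbitRel.Quotient G M)) q, rfl⟩
  have key : IsLocalDiffeomorphAt I I n
      (Quotient.mk _ : M → MulAction.orbitRel.Quotient G M) y := by
    refine ⟨⟨((chartAt H y).trans (chartAt H q).symm).toPartialEquiv,
      ((chartAt H y).trans (chartAt H q).symm).open_source,
      ((chartAt H y).trans (chartAt H q).symm).open_target, ?_, ?_⟩, ?_, ?_⟩
    · exact (contMDiffOn_chart_symm (n := n)).comp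
        ((contMDiffOn_chart (n := n)).mono fun z hz => hz.1) fun z hz => hz.2
    · exact (contMDiffOn_chart_symm (n := n)).comp
        ((contMDiffOn_chart (n := n)).mono fun z hz => hz.1) fun z hz => hz.2
    · change y ∈ ((chartAt H y).trans (chartAt H q).symm).source
      rw [hchart]
      simp
    · intro z hz
      have hz' : z ∈ (chartAt H y).source := hz.1
      change _ = (chartAt H q).symm (chartAt H y z)
      rw [hchart, OpenPartialHomeomorph.coe_trans_symm, Function.comp_apply,
        (chartAt H y).left_inv hz', hloc.localInverseAt_symm]
  -- The diffeomorphism g moves x to y and commutes with the projection, so the property passes from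
  -- y to x.
  obtain ⟨g, hg⟩ : ∃ g : G, g • x = y := Quotient.exact hy
  let Φ : Diffeomorph I I M M n :=
    ⟨MulAction.toPerm g, hG g, hG g⁻¹⟩
  have h := (Φ.isLocalDiffeomorph x).comp
    (g := (Quotient.mk _ : M → MulAction.orbitRel.Quotient G M))
    (P := MulAction.orbitRel.Quotient G M) (K := I) (by
      have : Φ x = y := hg
      rwa [this])
  convert! h using 1
  funext z
  exact (Quotient.sound ⟨g, rfl⟩ : (Quotient.mk _ (g • z) : MulAction.orbitRel.Quotient G M) =
    Quotient.mk _ z).symm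

end OrbitQuotient

/-! ### The equation of the invariant space of the trefoil knot -/

theorem toQ_apply (p : puncturedPlane) :
    (((toQ p : ClassQ) : Matrix.SpecialLinearGroup (Fin 2) ℂ) : Matrix (Fin 2) (Fin 2) ℂ) =
      !![1 - p.1.1 * p.1.2, -p.1.2 ^ 2; p.1.1 ^ 2, 1 + p.1.1 * p.1.2] := rfl

theorem classQ_ext {x y : ClassQ} (h : ((x : Matrix.SpecialLinearGroup (Fin 2) ℂ) :
    Matrix (Fin 2) (Fin 2) ℂ) = ((y : Matrix.SpecialLinearGroup (Fin 2) ℂ) :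
    Matrix (Fin 2) (Fin 2) ℂ)) : x = y :=
  Subtype.ext (Subtype.ext h)

theorem matC_coe : (matC : Matrix (Fin 2) (Fin 2) ℂ) = !![1, 0; 1, 1] := rfl

/-- Write C = 1 + E with E of rank one. Then c C c⁻¹ = 1 + c E c⁻¹, and c E c⁻¹ is the second column
of c times the first row of c⁻¹. That row is the required (a, b). -/
theorem toQ_surjective : Function.Surjective toQ := by
  rintro ⟨g, hg⟩
  obtain ⟨c, rfl⟩ := isConj_iff.1 hg
  have hdet := c.det_coe
  rw [Matrix.det_fin_two] at hdet
  have hp : (c 1 1, -c 0 1) ≠ (0 : ℂ × ℂ) := by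
    intro h
    simp only [Prod.mk_eq_zero, neg_eq_zero] at h
    simp [h.1, h.2] at hdet
  refine ⟨⟨(c 1 1, -c 0 1), hp⟩, classQ_ext ?_⟩
  rw [toQ_apply]
  ext i j
  simp only [Matrix.SpecialLinearGroup.coe_mul, Matrix.SpecialLinearGroup.coe_inv,
    Matrix.adjugate_fin_two, matC_coe, Matrix.mul_apply, Fin.sum_univ_two]
  fin_cases i <;> fin_cases j <;> simp <;>
    first | ring1 | linear_combination -hdet

/-- The entries a² and b² fix each coordinate up to its own sign, and ab ties the two signs
together. If the signs disagree then ab = 0, and the sign of the vanishing coordinate is immaterial.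
-/
theorem toQ_eq_toQ_iff {p q : puncturedPlane} : toQ p = toQ q ↔ p = q ∨ p = (-1 : ℤˣ) • q := by
  constructor
  · intro h
    have h' := congrArg (fun x : ClassQ =>
      ((x : Matrix.SpecialLinearGroup (Fin 2) ℂ) : Matrix (Fin 2) (Fin 2) ℂ)) h
    simp only [toQ_apply] at h'
    have h₁ : p.1.1 ^ 2 = q.1.1 ^ 2 := by simpa using congrFun (congrFun h' 1) 0
    have h₂ : p.1.2 ^ 2 = q.1.2 ^ 2 := by simpa using congrFun (congrFun h' 0) 1
    have h₃ : p.1.1 * p.1.2 = q.1.1 * q.1.2 := by simpa using congrFun (congrFun h' 1) 1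
    have key : p.1 = q.1 ∨ p.1 = -q.1 := by
      rcases sq_eq_sq_iff_eq_or_eq_neg.1 h₁ with ha | ha <;>
      rcases sq_eq_sq_iff_eq_or_eq_neg.1 h₂ with hb | hb
      · exact Or.inl (Prod.ext ha hb)
      · have h₄ : q.1.1 * q.1.2 = 0 := by rw [ha, hb] at h₃; linear_combination -h₃ / 2
        rcases mul_eq_zero.1 h₄ with h | h
        · exact Or.inr (Prod.ext (by simp [ha, h]) hb)
        · exact Or.inl (Prod.ext ha (by simp [hb, h]))
      · have h₄ : q.1.1 * q.1.2 = 0 := by rw [ha, hb] at h₃; linear_combination -h₃ / 2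
        rcases mul_eq_zero.1 h₄ with h | h
        · exact Or.inl (Prod.ext (by simp [ha, h]) hb)
        · exact Or.inr (Prod.ext ha (by simp [hb, h]))
      · exact Or.inr (Prod.ext ha hb)
    rcases key with h | h
    · exact Or.inl (Subtype.ext h)
    · exact Or.inr (Subtype.ext (by simp [puncturedPlane.coe_smul, h]))
  · rintro (rfl | rfl)
    · rfl
    · exact toQ_smul _ _

/-- The trace of the product of two elements of `Q`. -/
def traceMul (x : Fin 2 → ClassQ) : ℂ :=
  Matrix.trace (((x 0 : Matrix.SpecialLinearGroup (Fin 2) ℂ) : Matrix (Fin 2) (Fin 2) ℂ) *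
    ((x 1 : Matrix.SpecialLinearGroup (Fin 2) ℂ) : Matrix (Fin 2) (Fin 2) ℂ))

/-- The determinant of two vectors in the plane. -/
def planeDet (p q : ℂ × ℂ) : ℂ := p.1 * q.2 - p.2 * q.1

/-- The nilpotent parts N_p, N_q are traceless and tr(N_p N_q) = -det(p, q)². -/
theorem traceMul_toQ (p q : puncturedPlane) :
    traceMul ![toQ p, toQ q] = 2 - planeDet p.1 q.1 ^ 2 := by
  simp only [traceMul, Matrix.cons_val_zero, Matrix.cons_val_one, toQ_apply, Matrix.trace_fin_two,
    Matrix.mul_apply, Fin.sum_univ_two, planeDet]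
  simp
  ring

theorem planeDet_companion (p : puncturedPlane) (α : ℂ) :
    planeDet p.1 (companion p α).1 = 1 := by
  have h := tilde_spec p.2
  simp only [planeDet, companion]
  linear_combination h

/-- The pairing with (ã, b̃) is 1 on p and 0 on (-b̃, ã), so it reads off the coefficient α of q = α
p + (-b̃, ã). -/
theorem companion_of_planeDet_eq_one {p q : puncturedPlane} (h : planeDet p.1 q.1 = 1) :
    q = companion p (q.1.1 * tilde₁ p + q.1.2 * tilde₂ p) := by
  have ht := tilde_spec p.2
  simp only [planeDet] at h
  refine Subtype.ext (Prod.ext ?_ ?_)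
  · simp only [companion]
    linear_combination (-tilde₂ p) * h - q.1.1 * ht
  · simp only [companion]
    linear_combination (tilde₁ p) * h - q.1.2 * ht

/-- A permutation and its inverse have the same fixed points, so σ₁³ may replace σ₁⁻³. Comparing
first coordinates already gives the braid relation, which conversely yields both coordinates. -/
theorem mem_invariantSpace_iff {x : Fin 2 → ClassQ} :
    x ∈ invariantSpace ClassQ trefoilBraid ↔
      (x 0 : Matrix.SpecialLinearGroup (Fin 2) ℂ) * x 1 * x 0 = x 1 * x 0 * x 1 := by
  have h : (braidAction ClassQ 2 trefoilBraid).unop =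
      (elementaryBraidPerm ClassQ (n := 2) 0 ^ 3)⁻¹ := by
    have h₁ : braidAction ClassQ 2 (BraidGroup.σ 0) =
        MulOpposite.op (elementaryBraidPerm ClassQ (n := 2) 0) :=
      PresentedGroup.toGroup.of elementaryBraidPerm_relations
    rw [trefoilBraid, map_zpow, h₁, zpow_neg]
    rfl
  have h' : x ∈ invariantSpace ClassQ trefoilBraid ↔
      elementaryBraidMap (X := ClassQ) (n := 2) 0
        (elementaryBraidMap (n := 2) 0 (elementaryBraidMap (n := 2) 0 x)) = x := by
    change (braidAction ClassQ 2 trefoilBraid).unop x = x ↔ _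
    rw [h, Equiv.Perm.inv_eq_iff_eq]
    exact eq_comm
  rw [h']
  have e : ∀ y : Fin 2 → ClassQ, elementaryBraidMap (X := ClassQ) (n := 2) 0 y =
      ![y 1, TopologicalQuandle.op (y 0) (y 1)] := by
    intro y
    funext j
    fin_cases j <;> simp [elementaryBraidMap]
  simp only [e]
  have e' : ∀ y z : ClassQ, ((TopologicalQuandle.op y z : ClassQ) :
    Matrix.SpecialLinearGroup (Fin 2) ℂ) = (z : Matrix.SpecialLinearGroup (Fin 2) ℂ)⁻¹ * y * z :=
    fun y z => rfl
  generalize hu : (x 0 : Matrix.SpecialLinearGroup (Fin 2) ℂ) = u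
  generalize hv : (x 1 : Matrix.SpecialLinearGroup (Fin 2) ℂ) = v
  constructor
  · intro hx
    have h0 := congrArg Subtype.val (congrFun hx 0)
    simp only [Matrix.cons_val_zero, Matrix.cons_val_one, e', hu, hv] at h0
    have h1 := congrArg (fun z => u * v * z) h0
    simpa [mul_assoc] using h1.symm
  · intro hx
    have h0 : (v⁻¹ * u * v)⁻¹ * v * (v⁻¹ * u * v) = u := by
      apply mul_left_cancel (a := u * v)
      simpa [mul_assoc] using hx.symm
    funext j
    apply Subtype.ext
    fin_cases j
    · simpa [e', hu, hv, mul_assoc] using h0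
    · have h1 : u⁻¹ * (v⁻¹ * u * v) * u = v := by
        apply mul_left_cancel (a := v * u)
        simpa [mul_assoc] using hx
      simp only [Fin.mk_one, Matrix.cons_val_zero, Matrix.cons_val_one, e', hu, hv, h0, h1]

/-- Both directions are, entry by entry, the identity M_p M_q M_p - M_q M_p M_q = (1 - D²)(M_p -
M_q) with D = det(p, q). -/
theorem mem_invariantSpace_toQ_iff {p q : puncturedPlane} :
    ![toQ p, toQ q] ∈ invariantSpace ClassQ trefoilBraid ↔
      toQ p = toQ q ∨ planeDet p.1 q.1 ^ 2 = 1 := by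
  rw [mem_invariantSpace_iff]
  simp only [Matrix.cons_val_zero, Matrix.cons_val_one]
  constructor
  · intro h
    by_cases hD : planeDet p.1 q.1 ^ 2 = 1
    · exact Or.inr hD
    left
    have h' := congrArg (fun x : Matrix.SpecialLinearGroup (Fin 2) ℂ =>
      (x : Matrix (Fin 2) (Fin 2) ℂ)) h
    simp only [Matrix.SpecialLinearGroup.coe_mul, toQ_apply] at h'
    have hD' : 1 - planeDet p.1 q.1 ^ 2 ≠ 0 := fun h => hD (by linear_combination -h)
    have hij := fun i j => congrFun (congrFun h' i) j
    refine classQ_ext ?_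
    rw [toQ_apply, toQ_apply]
    have h00 := hij 0 0
    have h01 := hij 0 1
    have h10 := hij 1 0
    have h11 := hij 1 1
    simp only [Matrix.mul_apply, Fin.sum_univ_two, Matrix.of_apply, Matrix.cons_val',
      Matrix.cons_val_zero, Matrix.cons_val_one, Matrix.cons_val_fin_one] at h00 h01 h10 h11
    ext i j
    apply mul_left_cancel₀ hD'
    simp only [planeDet]
    fin_cases i <;> fin_cases j <;> simp only [Fin.zero_eta, Fin.mk_one, Matrix.of_apply,
      Matrix.cons_val', Matrix.cons_val_zero, Matrix.cons_val_one, Matrix.cons_val_fin_one]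
    · linear_combination h00
    · linear_combination h01
    · linear_combination h10
    · linear_combination h11
  · rintro (h | h)
    · rw [h]
    · apply Subtype.ext
      simp only [Matrix.SpecialLinearGroup.coe_mul, toQ_apply]
      simp only [planeDet] at h
      ext i j
      simp only [Matrix.mul_apply, Fin.sum_univ_two]
      fin_cases i <;> fin_cases j <;> simp
      · linear_combination (p.1.1 * p.1.2 - q.1.1 * q.1.2) * h
      · linear_combination (p.1.2 ^ 2 - q.1.2 ^ 2) * h
      · linear_combination (q.1.1 ^ 2 - p.1.1 ^ 2) * h
      · linear_combination (q.1.1 * q.1.2 - p.1.1 * p.1.2) * h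

/-! ### Topology of `Q` and of the quotients -/

/-- The projection `ℂ² ∖ {0} → Y`. -/
def projY (p : puncturedPlane) : SpaceY := Quotient.mk _ p

/-- The projection `S³ → ℝP³`. -/
def projRP3 (x : S3) : RP3 := Quotient.mk _ x

theorem projY_eq_iff {p q : puncturedPlane} : projY p = projY q ↔ p = q ∨ p = (-1 : ℤˣ) • q := by
  refine Quotient.eq.trans ⟨?_, ?_⟩
  · rintro ⟨u, rfl⟩
    rcases Int.units_eq_one_or u with rfl | rfl
    · exact Or.inl (one_smul _ _)
    · exact Or.inr rfl
  · rintro (rfl | rfl)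
    · exact ⟨1, one_smul _ _⟩
    · exact ⟨-1, rfl⟩

theorem projY_smul (u : ℤˣ) (p : puncturedPlane) : projY (u • p) = projY p :=
  Quotient.sound ⟨u, rfl⟩

theorem projRP3_smul (u : ℤˣ) (x : S3) : projRP3 (u • x) = projRP3 x :=
  Quotient.sound ⟨u, rfl⟩

theorem projY_surjective : Function.Surjective projY := Quotient.mk_surjective

theorem projRP3_surjective : Function.Surjective projRP3 := Quotient.mk_surjective

theorem isOpenQuotientMap_projY : IsOpenQuotientMap projY :=
  ⟨projY_surjective, continuous_quotient_mk', isOpenMap_quotient_mk'_mul⟩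

theorem isOpenQuotientMap_projRP3 : IsOpenQuotientMap projRP3 :=
  ⟨projRP3_surjective, continuous_quotient_mk', isOpenMap_quotient_mk'_mul⟩

theorem isLocalDiffeomorph_projY :
    IsLocalDiffeomorph 𝓘(ℝ, ℂ × ℂ) 𝓘(ℝ, ℂ × ℂ) ∞ projY :=
  isLocalDiffeomorph_orbitQuotient 𝓘(ℝ, ℂ × ℂ) ∞ (puncturedPlane.contMDiff_smul ∞)

theorem isLocalDiffeomorph_projRP3 : IsLocalDiffeomorph (𝓡 3) (𝓡 3) ∞ projRP3 :=
  isLocalDiffeomorph_orbitQuotient (𝓡 3) ∞ (S3.contMDiff_smul ∞)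

instance : PreconnectedSpace puncturedPlane :=
  isPreconnected_iff_preconnectedSpace.1
    (isConnected_compl_singleton_of_one_lt_rank (by
      rw [rank_prod', Complex.rank_real_complex]; norm_num) 0).isPreconnected

/-- The entries of an element of `Q`. -/
def entriesQ (x : ClassQ) : Fin 2 → Fin 2 → ℂ :=
  fun i j => (x : Matrix.SpecialLinearGroup (Fin 2) ℂ) i j

theorem isEmbedding_entriesQ : Topology.IsEmbedding entriesQ :=
  (Topology.IsEmbedding.subtypeVal (p := fun A : Matrix (Fin 2) (Fin 2) ℂ => A.det = 1)).comp
    Topology.IsEmbedding.subtypeVal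

theorem isEmbedding_matrixEntries : Topology.IsEmbedding matrixEntries :=
  Topology.IsEmbedding.piMap fun _ => isEmbedding_entriesQ

/-- The entries of the matrix `[[1 - ab, -b²], [a², 1 + ab]]`. -/
def quad (p : ℂ × ℂ) : Fin 2 → Fin 2 → ℂ :=
  ![![1 - p.1 * p.2, -p.2 ^ 2], ![p.1 ^ 2, 1 + p.1 * p.2]]

theorem entriesQ_toQ (p : puncturedPlane) : entriesQ (toQ p) = quad p.1 := rfl

theorem contDiff_quad : ContDiff ℝ ∞ quad := by
  refine contDiff_pi.2 fun i => contDiff_pi.2 fun j => ?_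
  fin_cases i <;> fin_cases j <;> simp [quad] <;> fun_prop

theorem continuous_toQ : Continuous toQ :=
  isEmbedding_entriesQ.continuous_iff.2 (contDiff_quad.continuous.comp continuous_subtype_val)

/-- The entries a² and b² give ‖p‖² ≤ ‖quad p‖ for the sup norms, so `quad` is proper on all of ℂ².
-/
theorem isClosedMap_quad : IsClosedMap quad := by
  refine (isProperMap_iff_tendsto_cocompact.2 ⟨contDiff_quad.continuous, ?_⟩).isClosedMap
  rw [← Metric.cobounded_eq_cocompact (α := Fin 2 → Fin 2 → ℂ),
    ← tendsto_norm_atTop_iff_cobounded]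
  have h : ∀ p : ℂ × ℂ, ‖p‖ ^ 2 ≤ ‖quad p‖ := by
    intro p
    have h₁ : ‖p.1‖ ^ 2 ≤ ‖quad p‖ := by
      have := (norm_le_pi_norm (quad p 1) 0).trans (norm_le_pi_norm (quad p) 1)
      simpa [quad] using this
    have h₂ : ‖p.2‖ ^ 2 ≤ ‖quad p‖ := by
      have := (norm_le_pi_norm (quad p 0) 1).trans (norm_le_pi_norm (quad p) 0)
      simpa [quad] using this
    rw [Prod.norm_def]
    rcases max_choice ‖p.1‖ ‖p.2‖ with h | h <;> rwa [h]
  exact Filter.tendsto_atTop_mono h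
    ((Filter.tendsto_pow_atTop two_ne_zero).comp tendsto_norm_cocompact_atTop)

/-- A closed set of the punctured plane is the trace of a closed K in ℂ². Whether K contains the
origin does not matter: `quad` sends 0 to the identity matrix, which is not in Q. -/
theorem isClosedMap_toQ : IsClosedMap toQ := by
  intro C hC
  obtain ⟨K, hK, rfl⟩ := isClosed_induced_iff.1 hC
  have h : toQ '' (Subtype.val ⁻¹' K) = entriesQ ⁻¹' (quad '' K) := by
    ext x
    constructor
    · rintro ⟨p, hp, rfl⟩
      exact ⟨p.1, hp, rfl⟩
    · rintro ⟨k, hk, hkx⟩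
      have hk0 : k ≠ 0 := by
        rintro rfl
        obtain ⟨p, rfl⟩ := toQ_surjective x
        rw [entriesQ_toQ] at hkx
        have h₁ := congrFun (congrFun hkx 1) 0
        have h₂ := congrFun (congrFun hkx 0) 1
        simp [quad] at h₁ h₂
        have h₃ : p.1.1 = 0 := by simpa using h₁.symm
        exact p.2 (Prod.ext h₃ h₂)
      exact ⟨⟨k, hk0⟩, hk, isEmbedding_entriesQ.injective hkx⟩
  rw [h]
  exact (isClosedMap_quad K hK).preimage isEmbedding_entriesQ.continuous

/-- The bijection `Y → Q`. -/
def yToQ (y : SpaceY) : ClassQ :=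
  Quotient.lift toQ (by
    rintro _ p ⟨u, rfl⟩
    exact toQ_smul u p) y

theorem yToQ_surjective : Function.Surjective yToQ := fun x =>
  (toQ_surjective x).imp' projY fun _ h => h

theorem isClosedEmbedding_yToQ : Topology.IsClosedEmbedding yToQ := by
  refine .of_continuous_injective_isClosedMap
    (isOpenQuotientMap_projY.isQuotientMap.continuous_iff.2 continuous_toQ) ?_ ?_
  · intro y z h
    obtain ⟨p, rfl⟩ := projY_surjective y
    obtain ⟨q, rfl⟩ := projY_surjective z
    exact projY_eq_iff.2 (toQ_eq_toQ_iff.1 h)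
  · intro C hC
    have h : yToQ '' C = toQ '' (projY ⁻¹' C) := by
      rw [show toQ = yToQ ∘ projY from rfl, Set.image_comp,
        Set.image_preimage_eq _ projY_surjective]
    rw [h]
    exact isClosedMap_toQ _ (hC.preimage isOpenQuotientMap_projY.continuous)

theorem tilde_denom_ne_zero {p : ℂ × ℂ} (hp : p ≠ 0) :
    ((‖p.1‖ ^ 2 + ‖p.2‖ ^ 2 : ℝ) : ℂ) ≠ 0 := by
  intro h
  have := tilde_spec hp
  -- Division by zero yields 0, so both tildes would vanish, against a ã + b b̃ = 1.
  simp [tilde₁, tilde₂, -Complex.ofReal_add, -Complex.ofReal_pow, h] at this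

theorem contDiffAt_tilde₁ {p : ℂ × ℂ} (hp : p ≠ 0) : ContDiffAt ℝ ∞ tilde₁ p := by
  have h : ContDiff ℝ ∞ fun p : ℂ × ℂ => ((‖p.1‖ ^ 2 + ‖p.2‖ ^ 2 : ℝ) : ℂ) :=
    Complex.ofRealCLM.contDiff.comp ((contDiff_fst.norm_sq ℝ).add (contDiff_snd.norm_sq ℝ))
  exact (Complex.conjCLE.contDiff.comp contDiff_fst).contDiffAt.mul
    (h.contDiffAt.inv (tilde_denom_ne_zero hp))

theorem contDiffAt_tilde₂ {p : ℂ × ℂ} (hp : p ≠ 0) : ContDiffAt ℝ ∞ tilde₂ p := by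
  have h : ContDiff ℝ ∞ fun p : ℂ × ℂ => ((‖p.1‖ ^ 2 + ‖p.2‖ ^ 2 : ℝ) : ℂ) :=
    Complex.ofRealCLM.contDiff.comp ((contDiff_fst.norm_sq ℝ).add (contDiff_snd.norm_sq ℝ))
  exact (Complex.conjCLE.contDiff.comp contDiff_snd).contDiffAt.mul
    (h.contDiffAt.inv (tilde_denom_ne_zero hp))

theorem continuous_tilde₁ : Continuous fun p : puncturedPlane => tilde₁ p.1 :=
  continuous_iff_continuousAt.2 fun p =>
    (contDiffAt_tilde₁ p.2).continuousAt.comp continuous_subtype_val.continuousAt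

theorem continuous_tilde₂ : Continuous fun p : puncturedPlane => tilde₂ p.1 :=
  continuous_iff_continuousAt.2 fun p =>
    (contDiffAt_tilde₂ p.2).continuousAt.comp continuous_subtype_val.continuousAt

theorem continuous_companion : Continuous fun z : puncturedPlane × ℂ => companion z.1 z.2 := by
  have h₁ := continuous_tilde₁.comp (continuous_fst (X := puncturedPlane) (Y := ℂ))
  have h₂ := continuous_tilde₂.comp (continuous_fst (X := puncturedPlane) (Y := ℂ))
  simp only [Function.comp_def] at h₁ h₂
  refine Continuous.subtype_mk (Continuous.prodMk ?_ ?_) _ <;> fun_prop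

/-- The map `Y × ℂ → Y × Y` given by `([a, b], α) ↦ ([a, b], [α a - b̃, α b + ã])`. -/
noncomputable def companionY (z : SpaceY × ℂ) : SpaceY × SpaceY :=
  (z.1, Quotient.lift (fun p : puncturedPlane => projY (companion p z.2)) (by
    rintro _ p ⟨u, rfl⟩
    change projY (companion (u • p) z.2) = _
    rw [companion_smul, projY_smul]) z.1)

theorem companionY_projY (p : puncturedPlane) (α : ℂ) :
    companionY (projY p, α) = (projY p, projY (companion p α)) := rfl

/-- A left inverse of `companionY`. -/
noncomputable def companionYInv (z : SpaceY × SpaceY) : SpaceY × ℂ :=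
  -- The pairing of q with (ã, b̃) changes sign with p and with q. The factor det(p, q) changes sign
  -- likewise, and it equals 1 when q is a companion of p.
  (z.1, Quotient.lift₂ (fun p q : puncturedPlane =>
    planeDet p.1 q.1 * (q.1.1 * tilde₁ p.1 + q.1.2 * tilde₂ p.1)) (by
    rintro _ _ p q ⟨u, rfl⟩ ⟨v, rfl⟩
    rcases Int.units_eq_one_or u with rfl | rfl <;> rcases Int.units_eq_one_or v with rfl | rfl <;>
    simp [puncturedPlane.coe_smul, planeDet, tilde₁, tilde₂, -mul_eq_mul_right_iff,
      -mul_eq_mul_left_iff] <;> ring) z.1 z.2)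

theorem companionYInv_projY (p q : puncturedPlane) : companionYInv (projY p, projY q) =
    (projY p, planeDet p.1 q.1 * (q.1.1 * tilde₁ p.1 + q.1.2 * tilde₂ p.1)) := rfl

theorem continuous_companionY : Continuous companionY := by
  refine ((isOpenQuotientMap_projY.prodMap IsOpenQuotientMap.id).isQuotientMap.continuous_iff
    (g := companionY)).2 ?_
  exact (isOpenQuotientMap_projY.continuous.comp continuous_fst).prodMk
    (isOpenQuotientMap_projY.continuous.comp continuous_companion)

theorem continuous_companionYInv : Continuous companionYInv := by
  refine ((isOpenQuotientMap_projY.prodMap isOpenQuotientMap_projY).isQuotientMap.continuous_iff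
    (g := companionYInv)).2 ?_
  have h₁ := continuous_tilde₁.comp (continuous_fst (X := puncturedPlane) (Y := puncturedPlane))
  have h₂ := continuous_tilde₂.comp (continuous_fst (X := puncturedPlane) (Y := puncturedPlane))
  simp only [Function.comp_def] at h₁ h₂
  refine (isOpenQuotientMap_projY.continuous.comp continuous_fst).prodMk ?_
  change Continuous fun z : puncturedPlane × puncturedPlane =>
    planeDet z.1.1 z.2.1 * (z.2.1.1 * tilde₁ z.1.1 + z.2.1.2 * tilde₂ z.1.1)
  unfold planeDet
  fun_prop

theorem leftInverse_companionYInv : Function.LeftInverse companionYInv companionY := by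
  rintro ⟨y, α⟩
  obtain ⟨p, rfl⟩ := projY_surjective y
  have h := tilde_spec p.2
  rw [companionY_projY, companionYInv_projY, planeDet_companion]
  refine Prod.ext rfl ?_
  simp only [companion]
  linear_combination α * h

theorem parametrization_projY (p : puncturedPlane) (α : ℂ) :
    parametrization (projY p, α) = ![toQ p, toQ (companion p α)] := rfl

/-- Factor through Y × Y: `companionY` has a continuous left inverse, and Y × Y embeds in Q × Q. -/
theorem isEmbedding_parametrization : Topology.IsEmbedding parametrization := by
  have h := (Homeomorph.finTwoArrow (X := ClassQ)).symm.isEmbedding.comp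
    ((isClosedEmbedding_yToQ.isEmbedding.prodMap isClosedEmbedding_yToQ.isEmbedding).comp
      (leftInverse_companionYInv.isEmbedding continuous_companionYInv continuous_companionY))
  convert h using 1
  funext ⟨y, α⟩
  obtain ⟨p, rfl⟩ := projY_surjective y
  rfl

theorem isEmbedding_diag : Topology.IsEmbedding fun (y : ClassQ) (_ : Fin 2) => y :=
  Function.LeftInverse.isEmbedding (f := fun x : Fin 2 → ClassQ => x 0) (fun _ => rfl)
    (by fun_prop) (by fun_prop)

/-! ### The connected components of the invariant space -/

theorem exists_eq_toQ (x : Fin 2 → ClassQ) : ∃ p q, x = ![toQ p, toQ q] := by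
  obtain ⟨p, hp⟩ := toQ_surjective (x 0)
  obtain ⟨q, hq⟩ := toQ_surjective (x 1)
  refine ⟨p, q, ?_⟩
  funext i
  fin_cases i
  · exact hp.symm
  · exact hq.symm

theorem mem_range_parametrization_iff (p q : puncturedPlane) :
    ![toQ p, toQ q] ∈ Set.range parametrization ↔ planeDet p.1 q.1 ^ 2 = 1 := by
  constructor
  · rintro ⟨⟨y, α⟩, h⟩
    obtain ⟨r, rfl⟩ := projY_surjective y
    -- The trace gives D² without comparing the representatives (p, q) with those used by the
    -- parametrization.
    have h' := congrArg traceMul h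
    rw [parametrization_projY, traceMul_toQ, traceMul_toQ, planeDet_companion] at h'
    linear_combination h'
  · intro h
    rcases sq_eq_one_iff.1 h with h | h
    · rw [companion_of_planeDet_eq_one h]
      exact ⟨(projY p, _), rfl⟩
    -- If D = -1, replace q by -q, which represents the same matrix.
    · have h' : planeDet p.1 ((-1 : ℤˣ) • q : puncturedPlane).1 = 1 := by
        simp only [planeDet] at h
        simp [puncturedPlane.coe_smul, planeDet]
        linear_combination -h
      rw [← toQ_smul (-1) q, companion_of_planeDet_eq_one h']
      exact ⟨(projY p, _), rfl⟩

theorem traceMul_of_mem_range {x : Fin 2 → ClassQ} (hx : x ∈ Set.range parametrization) :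
    traceMul x = 1 := by
  obtain ⟨p, q, rfl⟩ := exists_eq_toQ x
  rw [traceMul_toQ, (mem_range_parametrization_iff p q).1 hx]
  norm_num

theorem traceMul_of_eq {x : Fin 2 → ClassQ} (hx : x 0 = x 1) : traceMul x = 2 := by
  obtain ⟨p, q, rfl⟩ := exists_eq_toQ x
  have hx' : toQ p = toQ q := hx
  rw [← hx', traceMul_toQ, planeDet]
  ring

theorem continuous_traceMul : Continuous traceMul := by
  have h : Continuous fun x : ClassQ =>
      ((x : Matrix.SpecialLinearGroup (Fin 2) ℂ) : Matrix (Fin 2) (Fin 2) ℂ) :=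
    continuous_subtype_val.comp continuous_subtype_val
  exact ((h.comp (continuous_apply 0)).matrix_mul (h.comp (continuous_apply 1))).matrix_trace

theorem invariantSpace_trefoilBraid : invariantSpace ClassQ trefoilBraid =
    {x | x 0 = x 1} ∪ Set.range parametrization := by
  ext x
  obtain ⟨p, q, rfl⟩ := exists_eq_toQ x
  rw [mem_invariantSpace_toQ_iff, Set.mem_union, mem_range_parametrization_iff]
  rfl

theorem isPreconnected_diagonal : IsPreconnected {x : Fin 2 → ClassQ | x 0 = x 1} := by
  have h : {x : Fin 2 → ClassQ | x 0 = x 1} =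
      Set.range fun (p : puncturedPlane) (_ : Fin 2) => toQ p := by
    ext x
    constructor
    · intro hx
      obtain ⟨p, hp⟩ := toQ_surjective (x 0)
      refine ⟨p, ?_⟩
      funext i
      fin_cases i
      · exact hp
      · exact hp.trans hx
    · rintro ⟨p, rfl⟩
      rfl
  rw [h]
  exact isPreconnected_range (continuous_pi fun _ => continuous_toQ)

theorem isPreconnected_range_parametrization : IsPreconnected (Set.range parametrization) := by
  have : PreconnectedSpace SpaceY :=
    ⟨projY_surjective.range_eq ▸ isPreconnected_range isOpenQuotientMap_projY.continuous⟩
  exact isPreconnected_range isEmbedding_parametrization.continuous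

/-- If a continuous function takes different constant values on two nonempty preconnected sets,
these are the connected components of their union. -/
theorem connectedComponentIn_union_left {X Z : Type*} [TopologicalSpace X] [TopologicalSpace Z]
    [T2Space Z] {f : X → Z} (hf : Continuous f) {A B : Set X} (hA : IsPreconnected A) {a b : Z}
    (hab : a ≠ b) (hfA : ∀ x ∈ A, f x = a) (hfB : ∀ x ∈ B, f x = b) {x : X} (hx : x ∈ A) :
    connectedComponentIn (A ∪ B) x = A := by
  refine Set.Subset.antisymm (fun y hy => ?_)
    (hA.subset_connectedComponentIn hx Set.subset_union_left)
  have hsub := connectedComponentIn_subset (A ∪ B) x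
  refine (hsub hy).resolve_right fun hyB => ?_
  obtain ⟨z, hz, hza, hzb⟩ := isPreconnected_closed_iff.1 isPreconnected_connectedComponentIn
    (f ⁻¹' {a}) (f ⁻¹' {b}) (isClosed_singleton.preimage hf) (isClosed_singleton.preimage hf)
    (hsub.trans (Set.union_subset_union hfA hfB))
    ⟨x, mem_connectedComponentIn (Or.inl hx), hfA x hx⟩ ⟨y, hy, hfB y hyB⟩
  exact hab (hza.symm.trans hzb)

theorem components_invariantSpace_trefoilBraid :
    {K : Set (Fin 2 → ClassQ) | ∃ x ∈ invariantSpace ClassQ trefoilBraid,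
        K = connectedComponentIn (invariantSpace ClassQ trefoilBraid) x} =
      {{x | x 0 = x 1}, Set.range parametrization} := by
  have hd : ∀ x : Fin 2 → ClassQ, x ∈ {x : Fin 2 → ClassQ | x 0 = x 1} → traceMul x = 2 :=
    fun x hx => traceMul_of_eq hx
  have hp : ∀ x ∈ Set.range parametrization, traceMul x = 1 := fun x hx => traceMul_of_mem_range hx
  have h₁ : ∀ x ∈ {x : Fin 2 → ClassQ | x 0 = x 1},
      connectedComponentIn (invariantSpace ClassQ trefoilBraid) x = {x | x 0 = x 1} := by
    intro x hx
    rw [invariantSpace_trefoilBraid]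
    exact connectedComponentIn_union_left continuous_traceMul isPreconnected_diagonal
      (by norm_num) hd hp hx
  have h₂ : ∀ x ∈ Set.range parametrization,
      connectedComponentIn (invariantSpace ClassQ trefoilBraid) x = Set.range parametrization := by
    intro x hx
    rw [invariantSpace_trefoilBraid, Set.union_comm]
    exact connectedComponentIn_union_left continuous_traceMul isPreconnected_range_parametrization
      (by norm_num) hp hd hx
  let p₀ : puncturedPlane := ⟨(1, 0), by simp [puncturedPlane]⟩
  ext K
  simp only [Set.mem_ofPred_eq, Set.mem_insert_iff, Set.mem_singleton_iff]
  constructor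
  · rintro ⟨x, hx, rfl⟩
    have hx' := hx
    rw [invariantSpace_trefoilBraid] at hx'
    exact hx'.imp (h₁ x) (h₂ x)
  · have hsub := invariantSpace_trefoilBraid
    rintro (rfl | rfl)
    · have hx : (fun _ => toQ p₀) ∈ {x : Fin 2 → ClassQ | x 0 = x 1} := rfl
      exact ⟨_, hsub ▸ Or.inl hx, (h₁ _ hx).symm⟩
    · have hx : parametrization (projY p₀, 0) ∈ Set.range parametrization := ⟨_, rfl⟩
      exact ⟨_, hsub ▸ Or.inr hx, (h₂ _ hx).symm⟩

theorem diagonal_ne_range_parametrization :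
    {x : Fin 2 → ClassQ | x 0 = x 1} ≠ Set.range parametrization := by
  let p₀ : puncturedPlane := ⟨(1, 0), by simp [puncturedPlane]⟩
  intro h
  have hx : (fun _ => toQ p₀) ∈ {x : Fin 2 → ClassQ | x 0 = x 1} := rfl
  have h₁ := traceMul_of_eq (x := fun _ => toQ p₀) rfl
  rw [h] at hx
  rw [traceMul_of_mem_range hx] at h₁
  norm_num at h₁

/-! ### Polar coordinates -/

/-- A linear isomorphism `ℝ⁴ ≃ ℂ²`. -/
noncomputable def planeEquiv : EuclideanSpace ℝ (Fin 4) ≃L[ℝ] ℂ × ℂ :=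
  ContinuousLinearEquiv.ofFinrankEq (by simp)

/-- A linear isomorphism `ℝ³ ≃ ℝ × ℂ`. -/
noncomputable def spaceEquiv : EuclideanSpace ℝ (Fin 3) ≃L[ℝ] ℝ × ℂ :=
  ContinuousLinearEquiv.ofFinrankEq (by simp)

theorem planeEquiv_symm_ne_zero (p : puncturedPlane) : planeEquiv.symm (p : ℂ × ℂ) ≠ 0 := by
  rw [Ne, EmbeddingLike.map_eq_zero_iff]
  exact p.2

/-- Polar coordinates on `ℂ² ∖ {0}`. -/
noncomputable def polar : S3 × ℝ ≃ₜ puncturedPlane where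
  toFun z := ⟨planeEquiv (Real.exp z.2 • (z.1 : EuclideanSpace ℝ (Fin 4))), by
    have := ne_zero_of_mem_unit_sphere z.1
    simpa [puncturedPlane, Real.exp_ne_zero] using this⟩
  -- The norm is taken in ℝ⁴, so `planeEquiv` need not be an isometry. The real coordinate is the
  -- logarithm of the radius.
  invFun p := (⟨‖planeEquiv.symm p.1‖⁻¹ • planeEquiv.symm p.1, by
    have hp : planeEquiv.symm p.1 ≠ 0 := planeEquiv_symm_ne_zero p
    simp [norm_smul, hp]⟩, Real.log ‖planeEquiv.symm p.1‖)
  left_inv z := by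
    have hz : ‖(z.1 : EuclideanSpace ℝ (Fin 4))‖ = 1 := norm_eq_of_mem_sphere z.1
    refine Prod.ext (Subtype.ext ?_) ?_
    · simp [norm_smul, hz, smul_smul, Real.exp_ne_zero]
    · simp [norm_smul, hz]
  right_inv p := by
    have hp : planeEquiv.symm p.1 ≠ 0 := planeEquiv_symm_ne_zero p
    refine Subtype.ext ?_
    simp [Real.exp_log (norm_pos_iff.2 hp), smul_smul, hp]
  continuous_toFun := by
    refine Continuous.subtype_mk ?_ _
    fun_prop
  continuous_invFun := by
    have hp : ∀ p : puncturedPlane, ‖planeEquiv.symm p.1‖ ≠ 0 := fun p =>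
      norm_ne_zero_iff.2 (planeEquiv_symm_ne_zero p)
    have hc : Continuous fun p : puncturedPlane => planeEquiv.symm p.1 := by fun_prop
    refine Continuous.prodMk (Continuous.subtype_mk ?_ _) ?_
    · exact (hc.norm.inv₀ hp).smul hc
    · exact hc.norm.log hp

theorem polar_smul (u : ℤˣ) (x : S3) (t : ℝ) : polar (u • x, t) = u • polar (x, t) := by
  refine Subtype.ext ?_
  simp [polar, puncturedPlane.coe_smul, S3.coe_smul]

theorem polar_symm_smul (u : ℤˣ) (p : puncturedPlane) :
    polar.symm (u • p) = (u • (polar.symm p).1, (polar.symm p).2) := by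
  rw [Homeomorph.symm_apply_eq, polar_smul]
  simp

/-- Polar coordinates on `Y`. -/
noncomputable def polarY : RP3 × ℝ ≃ₜ SpaceY where
  toFun z := Quotient.lift (fun x : S3 => projY (polar (x, z.2))) (by
    rintro _ x ⟨u, rfl⟩
    change projY (polar (u • x, z.2)) = _
    rw [polar_smul, projY_smul]) z.1
  invFun := Quotient.lift (fun p : puncturedPlane =>
      (projRP3 (polar.symm p).1, (polar.symm p).2)) (by
    rintro _ p ⟨u, rfl⟩
    change (projRP3 (polar.symm (u • p)).1, (polar.symm (u • p)).2) = _
    rw [polar_symm_smul, projRP3_smul])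
  left_inv := by
    rintro ⟨y, t⟩
    obtain ⟨x, rfl⟩ := projRP3_surjective y
    change (projRP3 (polar.symm (polar (x, t))).1, (polar.symm (polar (x, t))).2) = _
    rw [Homeomorph.symm_apply_apply]
  right_inv := by
    intro y
    obtain ⟨p, rfl⟩ := projY_surjective y
    change projY (polar (polar.symm p)) = _
    rw [Homeomorph.apply_symm_apply]
  continuous_toFun := by
    refine
      (isOpenQuotientMap_projRP3.prodMap IsOpenQuotientMap.id).isQuotientMap.continuous_iff.2 ?_
    exact isOpenQuotientMap_projY.continuous.comp polar.continuous
  continuous_invFun := by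
    refine isOpenQuotientMap_projY.isQuotientMap.continuous_iff.2 ?_
    exact (isOpenQuotientMap_projRP3.continuous.comp
      (continuous_fst.comp polar.symm.continuous)).prodMk
      (continuous_snd.comp polar.symm.continuous)

/-- Polar coordinates on `Y × ℂ`. -/
noncomputable def polarYC : RP3 × EuclideanSpace ℝ (Fin 3) ≃ₜ SpaceY × ℂ :=
  (((Homeomorph.refl RP3).prodCongr spaceEquiv.toHomeomorph).trans
    (Homeomorph.prodAssoc RP3 ℝ ℂ).symm).trans (polarY.prodCongr (Homeomorph.refl ℂ))

/-! ### Differentials of the lifted maps -/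

/-- Exchanges the product manifold structure on V × W for its structure as a normed space. -/
theorem hasInjectiveMFDerivAt_prodMap_self {E H M E' H' M' V W : Type*}
    [NormedAddCommGroup E] [NormedSpace ℝ E] [TopologicalSpace H] {I : ModelWithCorners ℝ E H}
    [TopologicalSpace M] [ChartedSpace H M]
    [NormedAddCommGroup E'] [NormedSpace ℝ E'] [TopologicalSpace H'] {I' : ModelWithCorners ℝ E' H'}
    [TopologicalSpace M'] [ChartedSpace H' M'] [NormedAddCommGroup V] [NormedSpace ℝ V]
    [NormedAddCommGroup W] [NormedSpace ℝ W] {f : M → V} {g : M' → W} {x : M} {y : M'}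
    (hf : HasInjectiveMFDerivAt I 𝓘(ℝ, V) f x) (hg : HasInjectiveMFDerivAt I' 𝓘(ℝ, W) g y) :
    HasInjectiveMFDerivAt (I.prod I') 𝓘(ℝ, V × W) (Prod.map f g) (x, y) := by
  have h := hf.prodMap hg
  rwa [← modelWithCornersSelf_prod, chartedSpaceSelf_prod] at h

/-- A kernel vector (da, db) satisfies a da = 0, b db = 0 and a db + b da = 0. Whichever of a, b is
nonzero kills its own differential by its square, then the other one by the mixed term. -/
theorem hasInjectiveMFDerivAt_quad {p : ℂ × ℂ} (hp : p ≠ 0) :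
    HasInjectiveMFDerivAt 𝓘(ℝ, ℂ × ℂ) 𝓘(ℝ, Fin 2 → Fin 2 → ℂ) quad p := by
  have hd : HasFDerivAt quad (fderiv ℝ quad p) p :=
    (contDiff_quad.contDiffAt.differentiableAt (by simp)).hasFDerivAt
  refine HasInjectiveMFDerivAt.of_hasFDerivAt hd ?_
  rw [injective_iff_map_eq_zero]
  intro v hv
  have hc : ∀ i j, HasFDerivAt (fun q => quad q i j)
      ((ContinuousLinearMap.proj j).comp ((ContinuousLinearMap.proj i).comp (fderiv ℝ quad p))) p :=
    fun i j => hasFDerivAt_pi'.1 (hasFDerivAt_pi'.1 hd i) j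
  have h₁ : HasFDerivAt (𝕜 := ℝ) (fun q : ℂ × ℂ => q.1) _ p := hasFDerivAt_fst
  have h₂ : HasFDerivAt (𝕜 := ℝ) (fun q : ℂ × ℂ => q.2) _ p := hasFDerivAt_snd
  have e₁ := congrArg (fun L => L v) ((hc 1 0).unique (h₁.pow 2))
  have e₂ := congrArg (fun L => L v) ((hc 0 1).unique (h₂.pow 2).neg)
  have e₃ := congrArg (fun L => L v) ((hc 1 1).unique ((h₁.mul h₂).const_add 1))
  simp [hv] at e₁ e₂ e₃
  by_cases ha : p.1 = 0
  · have hb : p.2 ≠ 0 := fun hb => hp (Prod.ext ha hb)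
    have hv₂ := e₂.resolve_left hb
    exact Prod.ext (by simpa [ha, hb] using e₃) hv₂
  · have hv₁ := e₁.resolve_left ha
    exact Prod.ext hv₁ (by simpa [ha, hv₁] using e₃)

/-- The smooth map `ℂ² × ℂ² → M₂(ℂ) × M₂(ℂ)` given by two copies of `quad`. -/
def quadPair (z : (ℂ × ℂ) × (ℂ × ℂ)) : Fin 2 → Fin 2 → Fin 2 → ℂ := ![quad z.1, quad z.2]

theorem contDiff_quadPair : ContDiff ℝ ∞ quadPair := by
  refine contDiff_pi.2 fun k => ?_
  fin_cases k
  · exact contDiff_quad.comp contDiff_fst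
  · exact contDiff_quad.comp contDiff_snd

theorem hasInjectiveMFDerivAt_quadPair {z : (ℂ × ℂ) × (ℂ × ℂ)} (h₁ : z.1 ≠ 0) (h₂ : z.2 ≠ 0) :
    HasInjectiveMFDerivAt 𝓘(ℝ, (ℂ × ℂ) × (ℂ × ℂ)) 𝓘(ℝ, Fin 2 → Fin 2 → Fin 2 → ℂ) quadPair z := by
  have h := hasInjectiveMFDerivAt_prodMap_self (hasInjectiveMFDerivAt_quad h₁)
    (hasInjectiveMFDerivAt_quad h₂)
  rw [← modelWithCornersSelf_prod, chartedSpaceSelf_prod] at h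
  refine HasInjectiveMFDerivAt.of_comp (I'' := 𝓘(ℝ, (Fin 2 → Fin 2 → ℂ) × (Fin 2 → Fin 2 → ℂ)))
    (g := fun x : Fin 2 → Fin 2 → Fin 2 → ℂ => (x 0, x 1)) ?_ ?_ h
  · exact DifferentiableAt.mdifferentiableAt (by fun_prop)
  · exact (contDiff_quadPair.contDiffAt.differentiableAt (by simp)).mdifferentiableAt

theorem hasInjectiveMFDerivAt_quad_diag {p : ℂ × ℂ} (hp : p ≠ 0) :
    HasInjectiveMFDerivAt 𝓘(ℝ, ℂ × ℂ) 𝓘(ℝ, Fin 2 → Fin 2 → Fin 2 → ℂ)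
      (fun p (_ : Fin 2) => quad p) p := by
  refine HasInjectiveMFDerivAt.of_comp (I'' := 𝓘(ℝ, Fin 2 → Fin 2 → ℂ))
    (g := fun x : Fin 2 → Fin 2 → Fin 2 → ℂ => x 0) ?_ ?_ (hasInjectiveMFDerivAt_quad hp)
  · exact DifferentiableAt.mdifferentiableAt (by fun_prop)
  · exact ((contDiff_pi.2 fun _ => contDiff_quad).contDiffAt.differentiableAt
      (by simp)).mdifferentiableAt

/-- The map `(p, α) ↦ (p, (α a - b̃, α b + ã))` for `p = (a, b)`. -/
noncomputable def companionPair (z : (ℂ × ℂ) × ℂ) : (ℂ × ℂ) × (ℂ × ℂ) :=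
  (z.1, (z.2 * z.1.1 - tilde₂ z.1, z.2 * z.1.2 + tilde₁ z.1))

theorem contDiffAt_companionPair {z : (ℂ × ℂ) × ℂ} (hz : z.1 ≠ 0) :
    ContDiffAt ℝ ∞ companionPair z := by
  have h₁ := (contDiffAt_tilde₁ hz).comp z contDiffAt_fst
  have h₂ := (contDiffAt_tilde₂ hz).comp z contDiffAt_fst
  simp only [Function.comp_def] at h₁ h₂
  unfold companionPair
  fun_prop

theorem hasInjectiveMFDerivAt_companionPair {z : (ℂ × ℂ) × ℂ} (hz : z.1 ≠ 0) :
    HasInjectiveMFDerivAt 𝓘(ℝ, (ℂ × ℂ) × ℂ) 𝓘(ℝ, (ℂ × ℂ) × (ℂ × ℂ)) companionPair z := by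
  -- The left inverse recovers α by pairing the second vector with (ã, b̃). It is valid near z,
  -- where the first vector stays nonzero.
  refine HasInjectiveMFDerivAt.of_comp (I'' := 𝓘(ℝ, (ℂ × ℂ) × ℂ))
    (g := fun w : (ℂ × ℂ) × (ℂ × ℂ) => (w.1, w.2.1 * tilde₁ w.1 + w.2.2 * tilde₂ w.1)) ?_
    ((contDiffAt_companionPair hz).differentiableAt (by simp)).mdifferentiableAt ?_
  · have h₁ := ((contDiffAt_tilde₁ hz).comp (companionPair z) (f := Prod.fst)
      contDiffAt_fst).differentiableAt (by simp)
    have h₂ := ((contDiffAt_tilde₂ hz).comp (companionPair z) (f := Prod.fst)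
      contDiffAt_fst).differentiableAt (by simp)
    simp only [Function.comp_def] at h₁ h₂
    exact DifferentiableAt.mdifferentiableAt (by fun_prop)
  · refine (HasInjectiveMFDerivAt.id z).congr ?_
    filter_upwards [continuous_fst.continuousAt.eventually_ne hz] with w hw
    have h := tilde_spec hw
    refine Prod.ext rfl ?_
    simp only [id, Function.comp, companionPair]
    linear_combination (-w.2) * h

theorem quadPair_companionPair (p : puncturedPlane) (α : ℂ) :
    quadPair (companionPair (p.1, α)) = matrixEntries (parametrization (projY p, α)) := by
  funext k
  fin_cases k <;> rfl

theorem contDiffAt_quadPair_companionPair {z : (ℂ × ℂ) × ℂ} (hz : z.1 ≠ 0) :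
    ContDiffAt ℝ ∞ (quadPair ∘ companionPair) z :=
  contDiff_quadPair.contDiffAt.comp z (contDiffAt_companionPair hz)

theorem hasInjectiveMFDerivAt_quadPair_companionPair {z : (ℂ × ℂ) × ℂ} (hz : z.1 ≠ 0) :
    HasInjectiveMFDerivAt 𝓘(ℝ, (ℂ × ℂ) × ℂ) 𝓘(ℝ, Fin 2 → Fin 2 → Fin 2 → ℂ)
      (quadPair ∘ companionPair) z := by
  refine HasInjectiveMFDerivAt.comp (hasInjectiveMFDerivAt_quadPair hz ?_)
    (hasInjectiveMFDerivAt_companionPair hz)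
  exact (companion ⟨z.1, hz⟩ z.2).2

theorem fact_finrank_four : Fact (Module.finrank ℝ (EuclideanSpace ℝ (Fin 4)) = 3 + 1) := ⟨by simp⟩

theorem hasInjectiveMFDerivAt_coe_sphere (x : S3) :
    HasInjectiveMFDerivAt (𝓡 3) 𝓘(ℝ, EuclideanSpace ℝ (Fin 4)) (Subtype.val : S3 → _) x := by
  have := fact_finrank_four
  refine ⟨(contMDiff_coe_sphere (m := 1)).mdifferentiableAt (by simp), ?_⟩
  exact injective_mvfderiv_subtypeVal_sphere x

theorem hasInjectiveMFDerivAt_coe_puncturedPlane (p : puncturedPlane) :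
    HasInjectiveMFDerivAt 𝓘(ℝ, ℂ × ℂ) 𝓘(ℝ, ℂ × ℂ) (Subtype.val : puncturedPlane → ℂ × ℂ) p := by
  classical
  -- A left inverse of the inclusion. Its value at the origin is arbitrary, since only a
  -- neighbourhood of p matters.
  let r : ℂ × ℂ → puncturedPlane := fun q => if hq : q ≠ 0 then ⟨q, hq⟩ else p
  have hr : Subtype.val ∘ r =ᶠ[𝓝 (p : ℂ × ℂ)] id := by
    filter_upwards [isOpen_compl_singleton.mem_nhds p.2] with q hq
    have hq' : q ≠ 0 := hq
    simp [r, hq']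
  have hrp : r p = p := by
    have hp : (p : ℂ × ℂ) ≠ 0 := p.2
    simp [r, hp]
  have hrc : ContinuousAt r p :=
    Topology.IsInducing.subtypeVal.continuousAt_iff.2 (continuousAt_id.congr hr.symm)
  have hrs : ContMDiffAt 𝓘(ℝ, ℂ × ℂ) 𝓘(ℝ, ℂ × ℂ) ∞ r p :=
    (ContMDiffAt.iff_comp_isImmersionAt
      (Manifold.IsImmersionAt.of_opens puncturedPlane (r p).2)).2
      ⟨hrc, contMDiffAt_id.congr_of_eventuallyEq hr⟩
  refine HasInjectiveMFDerivAt.of_comp (I'' := 𝓘(ℝ, ℂ × ℂ)) (g := r)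
    (hrs.mdifferentiableAt (by simp)) (contMDiff_subtype_val.mdifferentiableAt (n := ∞) (by simp))
    ((HasInjectiveMFDerivAt.id p).congr (Filter.Eventually.of_forall fun q => ?_))
  have hq : (q : ℂ × ℂ) ≠ 0 := q.2
  simp [r, hq]

/-- The inverse of polar coordinates is smooth away from the origin. -/
theorem contDiffAt_polar_inv {y : EuclideanSpace ℝ (Fin 4)} (hy : y ≠ 0) :
    ContDiffAt ℝ ∞ (fun y : EuclideanSpace ℝ (Fin 4) => (‖y‖⁻¹ • y, Real.log ‖y‖)) y := by
  have h := contDiffAt_norm ℝ (n := ∞) hy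
  have hy' : ‖y‖ ≠ 0 := by simpa using hy
  exact ((h.inv hy').smul contDiffAt_id).prodMk (h.log hy')

theorem contMDiff_coe_polar :
    ContMDiff ((𝓡 3).prod 𝓘(ℝ, ℝ)) 𝓘(ℝ, ℂ × ℂ) ∞ fun z : S3 × ℝ => (polar z : ℂ × ℂ) := by
  have := fact_finrank_four
  have h₁ : ContMDiff ((𝓡 3).prod 𝓘(ℝ, ℝ)) 𝓘(ℝ, ℝ) ∞ fun z : S3 × ℝ => Real.exp z.2 :=
    Real.contDiff_exp.contMDiff.comp contMDiff_snd
  have h₂ : ContMDiff ((𝓡 3).prod 𝓘(ℝ, ℝ)) 𝓘(ℝ, EuclideanSpace ℝ (Fin 4)) ∞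
      fun z : S3 × ℝ => (z.1 : EuclideanSpace ℝ (Fin 4)) :=
    contMDiff_coe_sphere.comp contMDiff_fst
  exact planeEquiv.contDiff.contMDiff.comp (h₁.smul h₂)

theorem hasInjectiveMFDerivAt_coe_polar (z : S3 × ℝ) :
    HasInjectiveMFDerivAt ((𝓡 3).prod 𝓘(ℝ, ℝ)) 𝓘(ℝ, ℂ × ℂ)
      (fun z : S3 × ℝ => (polar z : ℂ × ℂ)) z := by
  have hz : planeEquiv.symm (polar z : ℂ × ℂ) ≠ 0 := planeEquiv_symm_ne_zero _
  -- Following `polar` by y ↦ (y / ‖y‖, log ‖y‖) gives the inclusion S³ × ℝ → ℝ⁴ × ℝ, whose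
  -- differential is injective.
  refine HasInjectiveMFDerivAt.of_comp (I'' := 𝓘(ℝ, EuclideanSpace ℝ (Fin 4) × ℝ))
    (g := (fun y : EuclideanSpace ℝ (Fin 4) => (‖y‖⁻¹ • y, Real.log ‖y‖)) ∘ planeEquiv.symm) ?_
    (contMDiff_coe_polar.mdifferentiableAt (by simp)) ?_
  · exact (((contDiffAt_polar_inv hz).comp _ planeEquiv.symm.contDiff.contDiffAt).differentiableAt
      (by simp)).mdifferentiableAt
  · have h := hasInjectiveMFDerivAt_prodMap_self (hasInjectiveMFDerivAt_coe_sphere z.1)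
      (HasInjectiveMFDerivAt.id (I := 𝓘(ℝ, ℝ)) z.2)
    refine h.congr (Filter.Eventually.of_forall fun w => ?_)
    have e := (polar.symm_apply_apply w).symm
    exact Prod.ext (congrArg (fun v : S3 × ℝ => (v.1 : EuclideanSpace ℝ (Fin 4))) e)
      (congrArg (fun v : S3 × ℝ => v.2) e)

/-! ### Smooth embeddings of the components -/

theorem isSmoothEmbedding_parametrization :
    Manifold.IsSmoothEmbedding (𝓘(ℝ, ℂ × ℂ).prod 𝓘(ℝ, ℂ)) 𝓘(ℝ, Fin 2 → Fin 2 → Fin 2 → ℂ) ∞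
      (matrixEntries ∘ parametrization) := by
  have hlift : (matrixEntries ∘ parametrization) ∘ Prod.map projY (id : ℂ → ℂ) =
      (quadPair ∘ companionPair) ∘ Prod.map (Subtype.val : puncturedPlane → ℂ × ℂ) id := by
    funext ⟨p, α⟩
    exact (quadPair_companionPair p α).symm
  refine isLocalDiffeomorph_projY.prodMap_id.isSmoothEmbedding_of_comp
    (projY_surjective.prodMap Function.surjective_id)
    (isEmbedding_matrixEntries.comp isEmbedding_parametrization) ?_ ?_
  · rw [hlift]
    rintro ⟨p, α⟩
    have h : ContMDiff (𝓘(ℝ, ℂ × ℂ).prod 𝓘(ℝ, ℂ)) 𝓘(ℝ, (ℂ × ℂ) × ℂ) ∞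
        (Prod.map (Subtype.val : puncturedPlane → ℂ × ℂ) (id : ℂ → ℂ)) :=
      (contMDiff_subtype_val.comp contMDiff_fst).prodMk_space contMDiff_snd
    exact (contDiffAt_quadPair_companionPair (z := (p.1, α)) p.2).contMDiffAt.comp (p, α) (h (p, α))
  · rw [hlift]
    rintro ⟨p, α⟩
    refine HasInjectiveMFDerivAt.comp ?_
      (hasInjectiveMFDerivAt_prodMap_self (hasInjectiveMFDerivAt_coe_puncturedPlane p)
        (HasInjectiveMFDerivAt.id α))
    exact hasInjectiveMFDerivAt_quadPair_companionPair (z := (p.1, α)) p.2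

theorem isDiffeomorphicTo_diagonal :
    IsDiffeomorphicTo (matrixEntries '' {x | x 0 = x 1}) ((𝓡 3).prod 𝓘(ℝ, ℝ)) (RP3 × ℝ) := by
  let f : RP3 × ℝ → Fin 2 → Fin 2 → Fin 2 → ℂ := fun z => matrixEntries fun _ => yToQ (polarY z)
  have hlift : f ∘ Prod.map projRP3 (id : ℝ → ℝ) =
      (fun p (_ : Fin 2) => quad p) ∘ fun z : S3 × ℝ => (polar z : ℂ × ℂ) := rfl
  refine ⟨f, isLocalDiffeomorph_projRP3.prodMap_id.isSmoothEmbedding_of_comp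
    (projRP3_surjective.prodMap Function.surjective_id) ?_ ?_ ?_, ?_⟩
  · exact isEmbedding_matrixEntries.comp (isEmbedding_diag.comp
      (isClosedEmbedding_yToQ.isEmbedding.comp polarY.isEmbedding))
  · rw [hlift]
    exact (contDiff_pi.2 fun _ => contDiff_quad).contMDiff.comp contMDiff_coe_polar
  · intro z
    rw [hlift]
    refine HasInjectiveMFDerivAt.comp ?_ (hasInjectiveMFDerivAt_coe_polar z)
    exact hasInjectiveMFDerivAt_quad_diag (polar z).2
  · ext v
    constructor
    · rintro ⟨z, rfl⟩
      exact ⟨_, rfl, rfl⟩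
    · rintro ⟨x, hx, rfl⟩
      obtain ⟨y, hy⟩ := yToQ_surjective (x 0)
      obtain ⟨z, rfl⟩ := polarY.surjective y
      refine ⟨z, congrArg matrixEntries ?_⟩
      funext i
      fin_cases i
      · exact hy
      · exact hy.trans hx

theorem isDiffeomorphicTo_range_parametrization :
    IsDiffeomorphicTo (matrixEntries '' Set.range parametrization)
      ((𝓡 3).prod (𝓡 3)) (RP3 × EuclideanSpace ℝ (Fin 3)) := by
  -- The lift of `polarYC` to S³ × ℝ³: one real coordinate is the logarithm of the radius, the other
  -- two are α.
  let m : S3 × EuclideanSpace ℝ (Fin 3) → (ℂ × ℂ) × ℂ := fun z =>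
    (polar (z.1, (spaceEquiv z.2).1), (spaceEquiv z.2).2)
  have hm0 : ∀ z, (m z).1 ≠ 0 := fun z => (polar (z.1, (spaceEquiv z.2).1)).2
  have hs : ContMDiff ((𝓡 3).prod (𝓡 3)) 𝓘(ℝ, ℝ × ℂ) ∞
      fun z : S3 × EuclideanSpace ℝ (Fin 3) => spaceEquiv z.2 :=
    spaceEquiv.contDiff.contMDiff.comp contMDiff_snd
  have hm : ContMDiff ((𝓡 3).prod (𝓡 3)) 𝓘(ℝ, (ℂ × ℂ) × ℂ) ∞ m :=
    (contMDiff_coe_polar.comp (contMDiff_fst.prodMk (contDiff_fst.contMDiff.comp hs))).prodMk_space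
      (contDiff_snd.contMDiff.comp hs)
  have hmi : ∀ z, HasInjectiveMFDerivAt ((𝓡 3).prod (𝓡 3)) 𝓘(ℝ, (ℂ × ℂ) × ℂ) m z := by
    intro z
    have hy : planeEquiv.symm (m z).1 ≠ 0 := planeEquiv_symm_ne_zero _
    have hp : ContDiffAt ℝ ∞ (fun w : (ℂ × ℂ) × ℂ =>
        (‖planeEquiv.symm w.1‖⁻¹ • planeEquiv.symm w.1, Real.log ‖planeEquiv.symm w.1‖)) (m z) :=
      (contDiffAt_polar_inv hy).comp (m z)
        (planeEquiv.symm.contDiff.comp contDiff_fst).contDiffAt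
    have hg : ContDiffAt ℝ ∞ (fun w : (ℂ × ℂ) × ℂ =>
        (‖planeEquiv.symm w.1‖⁻¹ • planeEquiv.symm w.1,
          spaceEquiv.symm (Real.log ‖planeEquiv.symm w.1‖, w.2))) (m z) :=
      hp.fst.prodMk (spaceEquiv.symm.contDiff.contDiffAt.comp _ (hp.snd.prodMk contDiffAt_snd))
    refine HasInjectiveMFDerivAt.of_comp
      (I'' := 𝓘(ℝ, EuclideanSpace ℝ (Fin 4) × EuclideanSpace ℝ (Fin 3)))
      (hg.differentiableAt (by simp)).mdifferentiableAt (hm.mdifferentiableAt (by simp)) ?_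
    refine (hasInjectiveMFDerivAt_prodMap_self (hasInjectiveMFDerivAt_coe_sphere z.1)
      (HasInjectiveMFDerivAt.id (I := 𝓘(ℝ, EuclideanSpace ℝ (Fin 3))) z.2)).congr
      (Filter.Eventually.of_forall fun w => ?_)
    have e := (polar.symm_apply_apply (w.1, (spaceEquiv w.2).1)).symm
    refine Prod.ext (congrArg (fun v : S3 × ℝ => (v.1 : EuclideanSpace ℝ (Fin 4))) e) ?_
    have e₂ := congrArg (fun v : S3 × ℝ => spaceEquiv.symm (v.2, (spaceEquiv w.2).2)) e
    refine Eq.trans ?_ e₂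
    exact (spaceEquiv.symm_apply_apply w.2).symm
  have hlift : ((matrixEntries ∘ parametrization) ∘ polarYC) ∘ Prod.map projRP3 id =
      (quadPair ∘ companionPair) ∘ m := by
    funext ⟨x, s⟩
    exact (quadPair_companionPair _ _).symm
  refine ⟨(matrixEntries ∘ parametrization) ∘ polarYC,
    isLocalDiffeomorph_projRP3.prodMap_id.isSmoothEmbedding_of_comp
    (projRP3_surjective.prodMap Function.surjective_id) ?_ ?_ ?_, ?_⟩
  · exact (isEmbedding_matrixEntries.comp isEmbedding_parametrization).comp polarYC.isEmbedding
  · rw [hlift]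
    exact fun z => (contDiffAt_quadPair_companionPair (hm0 z)).contMDiffAt.comp z (hm z)
  · rw [hlift]
    exact fun z => (hasInjectiveMFDerivAt_quadPair_companionPair (hm0 z)).comp (hmi z)
  · rw [polarYC.surjective.range_comp, Set.range_comp]

theorem proposition6p2 :
    -- the diagonal and the image of `Y × ℂ` are different and are exactly the connected components
    {K : Set (Fin 2 → ClassQ) | ∃ x ∈ invariantSpace ClassQ trefoilBraid,
        K = connectedComponentIn (invariantSpace ClassQ trefoilBraid) x} =
      {{x | x 0 = x 1}, Set.range parametrization} ∧
    {x : Fin 2 → ClassQ | x 0 = x 1} ≠ Set.range parametrization ∧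
    -- the diagonal is diffeomorphic to `ℝP³ × ℝ`
    IsDiffeomorphicTo (matrixEntries '' {x | x 0 = x 1}) ((𝓡 3).prod 𝓘(ℝ, ℝ)) (RP3 × ℝ) ∧
    -- the parametrization is a diffeomorphism of `Y × ℂ` onto its image
    Manifold.IsSmoothEmbedding (𝓘(ℝ, ℂ × ℂ).prod 𝓘(ℝ, ℂ)) 𝓘(ℝ, Fin 2 → Fin 2 → Fin 2 → ℂ) ∞
      (matrixEntries ∘ parametrization) ∧
    -- this image is diffeomorphic to `ℝP³ × ℝ³`
    IsDiffeomorphicTo (matrixEntries '' Set.range parametrization)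
      ((𝓡 3).prod (𝓡 3)) (RP3 × EuclideanSpace ℝ (Fin 3)) := by
  exact ⟨components_invariantSpace_trefoilBraid, diagonal_ne_range_parametrization,
    isDiffeomorphicTo_diagonal, isSmoothEmbedding_parametrization,
    isDiffeomorphicTo_range_parametrization⟩
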